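/- Let $\mathcal X$ be a real prehilbert space with scalar product $\langle\cdot,\cdot\rangle$, and let $\mathcal S$ be a set of finite-dimensional subspaces of $\mathcal X$ such that for all $X,Y\in\mathcal S$ one has $X\cap Y\in\mathcal S$ and $X+Y\subset G$ for some $G\in\mathcal S$. Each $X\in\mathcal S$ carries its Euclidean structure and Euclidean measure (the unit point mass if $X=\{0\}$), and $\mathcal H(X)=L^2(X)$. For $x\in X$ and $k\in\mathcal X$ define unitary operators in $\mathcal H(X)$ by $$(U_xu)(x')=u(x'+x),\qquad (V_ku)(x')=\mathrm e^{i\langle x',k\rangle}u(x').$$ Operators defined by the same formula in different spaces $\mathcal H(X)$, $\mathcal H(Y)$ are denoted by the same symbol. Let $\mathscr L_{XY}$ be the space of bounded operators $\mathcal H(Y)\to\mathcal H(X)$. Let $X,Y,Z\in\mathcal S$ with $Z\subset X\cap Y$, and let $G\in\mathcal S$ be any element with $X\cup Y\subset G$. Let $\mathscr T_{XY}\subset\mathscr L_{XY}$ be the norm closure of the set of operators $$(T_{XY}(\varphi)u)(x)=\int_Y\varphi(x-y)u(y)\,dy,\qquad \varphi\in C_{\mathrm c}(G).$$ Let $\mathcal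 C_Y(Z)$ be the algebra of operators in $\mathcal H(Y)$ of multiplication by the functions $\psi\circ\pi_Z$, where $\psi\in C_0(Y/Z)$ and $\pi_Z:Y\to Y/Z$ is the canonical surjection, and let $\mathscr C_{XY}(Z)=\mathscr T_{XY}\cdot\mathcal C_Y(Z)$ be the closed linear span in $\mathscr L_{XY}$ of the products $AB$ with $A\in\mathscr T_{XY}$, $B\in\mathcal C_Y(Z)$. Then $\mathscr C_{XY}(Z)$ is the set of $T\in\mathscr L_{XY}$ satisfying the following two conditions, where all limits are along the ordinary topologies of the finite-dimensional spaces, and $X\ominus Z=X\cap Z^\perp$, $Y\ominus Z=Y\cap Z^\perp$ (identified with $X/Z$ and $Y/Z$): 1. $U_z^*TU_z=T$ for all $z\in Z$, and $\|V_z^*TV_z-T\|\to0$ as $z\to0$ in $Z$; 2. $\|T(U_y-1)\|\to0$ as $y\to0$ in $Y$, and $\|T(V_k-1)\|\to0$ as $k\to0$ in $Y\ominus Z$. Moreover condition 2 may be replaced with the following one, that is, $\mathscr C_{XY}(Z)$ is also the set of $T\in\mathscr L_{XY}$ satisfying condition 1 and 3. $\|(U_x-1)T\|\to0$ as $x\to0$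 in $X$, and $\|(V_k-1)T\|\to0$ as $k\to0$ in $X\ominus Z$. -/

import Mathlib

open MeasureTheory Filter Topology
open scoped ENNReal CompactlySupported ZeroAtInfty BoundedContinuousFunction

noncomputable section

namespace ManyBody

variable {E : Type*} [NormedAddCommGroup E] [InnerProductSpace ℝ E]
  [MeasurableSpace E] [BorelSpace E]

/-- The Hilbert space `ℋ(X) = L²(X)` of a finite-dimensional subspace `X`, with respect to the
Euclidean measure of `X` (for `X = {0}` this is the unit mass at the origin, so `ℋ(X) ≅ ℂ`). -/
abbrev HilbertL2 (X : Submodule ℝ E) [FiniteDimensional ℝ X] : Type _ :=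
  Lp ℂ 2 (volume : Measure X)

/-- The bounded operator of multiplication by a bounded continuous function `f` on `L²(X)`. -/
def mulOp (X : Submodule ℝ E) [FiniteDimensional ℝ X] (f : X →ᵇ ℂ) :
    HilbertL2 X →L[ℂ] HilbertL2 X :=
  (ContinuousLinearMap.mul ℂ ℂ).holderL volume ∞ 2 2
    ((memLp_top_of_bound f.continuous.aestronglyMeasurable ‖f‖
      (Eventually.of_forall f.norm_coe_le_norm)).toLp f)

/-- `mulOp X f` acts as pointwise multiplication by `f`. -/
theorem coeFn_mulOp (X : Submodule ℝ E) [FiniteDimensional ℝ X] (f : X →ᵇ ℂ) (u : HilbertL2 X) :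
    mulOp X f u =ᵐ[volume] fun x => f x * u x := by
  have hf := memLp_top_of_bound (μ := (volume : Measure X))
    f.continuous.aestronglyMeasurable ‖f‖ (Eventually.of_forall f.norm_coe_le_norm)
  have h := (ContinuousLinearMap.mul ℂ ℂ).coeFn_holder (r := 2) (hf.toLp f) u
  filter_upwards [h, hf.coeFn_toLp] with x hx hx'
  have : mulOp X f u x = _ := hx
  rw [this, hx']
  rfl

/-- The translation operator `(U_x u)(x') = u(x' + x)` on `L²(X)`, for `x ∈ X`. -/
def translOp (X : Submodule ℝ E) [FiniteDimensional ℝ X] (x : X) :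
    HilbertL2 X →L[ℂ] HilbertL2 X :=
  (Lp.compMeasurePreservingₗᵢ ℂ (fun x' : X => x' + x)
    (measurePreserving_add_right volume x)).toContinuousLinearMap

/-- `translOp X x` acts as translation by `x`. -/
theorem coeFn_translOp (X : Submodule ℝ E) [FiniteDimensional ℝ X] (x : X) (u : HilbertL2 X) :
    translOp X x u =ᵐ[volume] fun x' => u (x' + x) :=
  Lp.coeFn_compMeasurePreserving u (measurePreserving_add_right volume x)

/-- The function `x ↦ exp(i⟨x, k⟩)` on `X`, for `k` in the ambient space. -/
def planeWave (X : Submodule ℝ E) (k : E) : X →ᵇ ℂ :=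
  BoundedContinuousFunction.ofNormedAddCommGroup
    (fun x : X => Complex.exp (Complex.I * ((inner ℝ (x : E) k : ℝ) : ℂ)))
    (by fun_prop) 1
    (fun x => by rw [mul_comm, Complex.norm_exp_ofReal_mul_I])

/-- The operator `V_k` on `L²(X)` of multiplication by `x ↦ exp(i⟨x, k⟩)`. -/
def phaseOp (X : Submodule ℝ E) [FiniteDimensional ℝ X] (k : E) :
    HilbertL2 X →L[ℂ] HilbertL2 X :=
  mulOp X (planeWave X k)

/-- The set of the bounded operators `T_{XY}(φ) : L²(Y) → L²(X)`, `φ ∈ C_c(G)`, given by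
`(T_{XY}(φ) u)(x) = ∫_Y φ(x - y) u(y) dy`, where `G` is a subspace containing `X` and `Y`. -/
def convOps (X Y G : Submodule ℝ E) [FiniteDimensional ℝ X] [FiniteDimensional ℝ Y]
    (hX : X ≤ G) (hY : Y ≤ G) : Set (HilbertL2 Y →L[ℂ] HilbertL2 X) :=
  {T | ∃ φ : C_c(G, ℂ), ∀ u : HilbertL2 Y, T u =ᵐ[volume]
    fun x => ∫ y : Y, φ (Submodule.inclusion hX x - Submodule.inclusion hY y) * u y}

/-- The space `𝒯_{XY}`: the norm closure of the set of operators `T_{XY}(φ)`, `φ ∈ C_c(G)`. -/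
def convSpace (X Y G : Submodule ℝ E) [FiniteDimensional ℝ X] [FiniteDimensional ℝ Y]
    (hX : X ≤ G) (hY : Y ≤ G) : Set (HilbertL2 Y →L[ℂ] HilbertL2 X) :=
  closure (convOps X Y G hX hY)

/-- The function `ψ ∘ π_Z` on `Y`, where `ψ ∈ C₀(Y/Z)` and `π_Z : Y → Y/Z` is the canonical
surjection (here `Z` is seen as the subspace `Z ∩ Y` of `Y`). -/
def liftQuot (Y Z : Submodule ℝ E) (ψ : C₀(Y ⧸ Z.submoduleOf Y, ℂ)) : Y →ᵇ ℂ :=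
  ψ.toBCF.compContinuous ⟨(Z.submoduleOf Y).mkQ, continuous_quot_mk⟩

/-- The algebra `𝒞_Y(Z) ≅ C₀(Y/Z)`, as a set of multiplication operators on `L²(Y)`. -/
def quotMulOps (Y Z : Submodule ℝ E) [FiniteDimensional ℝ Y] :
    Set (HilbertL2 Y →L[ℂ] HilbertL2 Y) :=
  Set.range fun ψ : C₀(Y ⧸ Z.submoduleOf Y, ℂ) => mulOp Y (liftQuot Y Z ψ)

/-- The space `𝒞_{XY}(Z) = 𝒯_{XY} · 𝒞_Y(Z)`: the closed linear span of the products `A B` with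
`A ∈ 𝒯_{XY}` and `B ∈ 𝒞_Y(Z)`. -/
def couplingSpace (X Y G Z : Submodule ℝ E) [FiniteDimensional ℝ X] [FiniteDimensional ℝ Y]
    (hX : X ≤ G) (hY : Y ≤ G) : Submodule ℂ (HilbertL2 Y →L[ℂ] HilbertL2 X) :=
  (Submodule.span ℂ
    {T | ∃ A ∈ convSpace X Y G hX hY, ∃ B ∈ quotMulOps Y Z, T = A ∘L B}).topologicalClosure

end ManyBody

end

open ManyBody

noncomputable section

namespace ManyBody

open scoped NNReal InnerProductSpace

set_option linter.unusedSectionVars false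

/-! View an operator through its columns: formally Tu = ∫ u(y) d(y) dy with d(y) in L²(X)
(`HasSections`). The column of T_{XY}(φ) at y is φ(· - y). If all columns have norm at most ε and,
for every x, the set of y whose column may be nonzero at x has volume at most C, then ‖T‖ ≤ ε√C
(`eLpNorm_inner_le_of_localized`, `HasSections.norm_le`). This Schur-type bound turns columnwise
approximation into norm approximation.

Necessity. Each condition defines a closed subspace (`isClosed_almostFixed`), so it is enough to
test it on products of T_{XY}(φ) with multiplication by ψ ∘ π_Z (`couplingSpace_le`). There it
follows from the effect of translations and phases on φ, and from ψ ∘ π_Z being Z-invariant,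
uniformly continuous and small far from Z.

Sufficiency of 1 and 2. The operator T is regularized three times, each time by an average. A
compactly supported multiplier g on Y ⊖ Z is a Fourier average of the V_k, so Tg is close to T
(`exists_cutoff_norm_comp_sub_le`). Convolution with a narrow bump ρ is an average of the U_y, so it
changes T little on the right and produces the continuous columns T(ρ(· - y))
(`exists_isConv_norm_comp_sub_le`). Averaging V_z^* S V_z over z in Z multiplies the kernel of S by
a function χ(π_Z x - π_Z y), π_Z here being the orthogonal projection onto Z; so S may be cut off
far from the diagonal in the direction of Z (`exists_cut_norm_sub_le`). What remains has columns
g(y^⊥) h(y), where y^⊥ is the component of y in Y ⊖ Z, and h is continuous, localized and satisfies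
h(y + z) = U_{-z} h(y) because T commutes with the U_z. Thus h is determined by its values on Y ⊖ Z,
of which only those on the compact support of g matter. There a partition of unity replaces h by
finitely many columns of convolution operators, and the Schur-type bound gives approximation by a
finite sum of generators (`mem_couplingSpace_of_hasSections`).

Condition 3. If T satisfies 1 and 3, then T^* satisfies 1 and 2 with X and Y exchanged, so T^* lies
in 𝒞_{YX}(Z). The necessity of 3 for T^* is condition 2 for T (`mem_couplingSpace_of_tendsto_left`).
-/

section

/-! ### Operators given by L²-valued columns, and a Schur-type bound. -/

section Sections

variable {α β γ : Type*} [MeasurableSpace α] [MeasurableSpace β] [MeasurableSpace γ]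
  {μ : Measure α} {ν : Measure β} {κ : Measure γ}

/-- `T : L²(ν) → L²(μ)` has sections `d : β → L²(μ)` if, formally, `T u = ∫ u(y) d(y) dν(y)`. -/
def HasSections (T : Lp ℂ 2 ν →L[ℂ] Lp ℂ 2 μ) (d : β → Lp ℂ 2 μ) : Prop :=
  ∀ v : Lp ℂ 2 μ, T.adjoint v =ᵐ[ν] fun y => ⟪d y, v⟫_ℂ

namespace HasSections

variable {T T₁ T₂ : Lp ℂ 2 ν →L[ℂ] Lp ℂ 2 μ} {d d₁ d₂ : β → Lp ℂ 2 μ}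

theorem comp_left (h : HasSections T d) (A : Lp ℂ 2 μ →L[ℂ] Lp ℂ 2 κ) :
    HasSections (A ∘L T) fun y => A (d y) := by
  intro v
  rw [ContinuousLinearMap.adjoint_comp]
  filter_upwards [h (A.adjoint v)] with y hy
  rw [ContinuousLinearMap.comp_apply, hy, ContinuousLinearMap.adjoint_inner_right]

theorem sub (h₁ : HasSections T₁ d₁) (h₂ : HasSections T₂ d₂) :
    HasSections (T₁ - T₂) fun y => d₁ y - d₂ y := by
  intro v
  rw [map_sub, sub_apply]
  filter_upwards [h₁ v, h₂ v, Lp.coeFn_sub (T₁.adjoint v) (T₂.adjoint v)] with y h1 h2 h3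
  rw [h3, Pi.sub_apply, h1, h2, inner_sub_left]

theorem zero : HasSections (0 : Lp ℂ 2 ν →L[ℂ] Lp ℂ 2 μ) fun _ => 0 := by
  intro v
  rw [map_zero, zero_apply]
  filter_upwards [Lp.coeFn_zero ℂ 2 ν] with y h
  rw [h, inner_zero_left, Pi.zero_apply]

theorem add (h₁ : HasSections T₁ d₁) (h₂ : HasSections T₂ d₂) :
    HasSections (T₁ + T₂) fun y => d₁ y + d₂ y := by
  intro v
  rw [map_add, add_apply]
  filter_upwards [h₁ v, h₂ v, Lp.coeFn_add (T₁.adjoint v) (T₂.adjoint v)] with y h1 h2 h3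
  rw [h3, Pi.add_apply, h1, h2, inner_add_left]

theorem sum {ι : Type*} (s : Finset ι) {T : ι → Lp ℂ 2 ν →L[ℂ] Lp ℂ 2 μ}
    {d : ι → β → Lp ℂ 2 μ} (h : ∀ i ∈ s, HasSections (T i) (d i)) :
    HasSections (∑ i ∈ s, T i) fun y => ∑ i ∈ s, d i y := by
  classical
  induction s using Finset.induction_on with
  | empty => simpa using zero
  | insert a s ha ih =>
    simp only [Finset.sum_insert ha]
    exact (h a (Finset.mem_insert_self a s)).add
      (ih fun i hi => h i (Finset.mem_insert_of_mem hi))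

theorem inner_apply (h : HasSections T d) (u : Lp ℂ 2 ν) (v : Lp ℂ 2 μ) :
    ⟪T u, v⟫_ℂ = ∫ y, ⟪u y, ⟪d y, v⟫_ℂ⟫_ℂ ∂ν := by
  rw [← ContinuousLinearMap.adjoint_inner_right, L2.inner_def]
  refine integral_congr_ae ?_
  filter_upwards [h v] with y hy
  rw [hy]

theorem integrable_inner (h : HasSections T d) (u : Lp ℂ 2 ν) (v : Lp ℂ 2 μ) :
    Integrable (fun y => ⟪u y, ⟪d y, v⟫_ℂ⟫_ℂ) ν := by
  refine (L2.integrable_inner (𝕜 := ℂ) u (T.adjoint v)).congr ?_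
  filter_upwards [h v] with y hy
  rw [hy]

theorem norm_le (h : HasSections T d) {M : ℝ} (hM : 0 ≤ M)
    (hd : ∀ v, eLpNorm (fun y => ⟪d y, v⟫_ℂ) 2 ν ≤ ENNReal.ofReal M * ‖v‖ₑ) : ‖T‖ ≤ M := by
  rw [← LinearIsometryEquiv.norm_map ContinuousLinearMap.adjoint T]
  refine ContinuousLinearMap.opNorm_le_bound _ hM fun v => ?_
  have h1 : ‖T.adjoint v‖ₑ ≤ ENNReal.ofReal M * ‖v‖ₑ := by
    rw [Lp.enorm_def, eLpNorm_congr_ae (h v)]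
    exact hd v
  rw [← ofReal_norm, ← ofReal_norm, ← ENNReal.ofReal_mul hM] at h1
  exact (ENNReal.ofReal_le_ofReal_iff (by positivity)).1 h1

end HasSections

/-- The map v ↦ ⟪d ·, v⟫ is linear and bounded into L²(ν), and T is its adjoint; weak measurability
of d suffices. -/
theorem exists_hasSections {d : β → Lp ℂ 2 μ}
    (hm : ∀ v, AEStronglyMeasurable (fun y => ⟪d y, v⟫_ℂ) ν) {M : ℝ} (hM : 0 ≤ M)
    (hd : ∀ v, eLpNorm (fun y => ⟪d y, v⟫_ℂ) 2 ν ≤ ENNReal.ofReal M * ‖v‖ₑ) :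
    ∃ T : Lp ℂ 2 ν →L[ℂ] Lp ℂ 2 μ, HasSections T d := by
  have hL : ∀ v, MemLp (fun y => ⟪d y, v⟫_ℂ) 2 ν := fun v =>
    ⟨hm v, (hd v).trans_lt (ENNReal.mul_lt_top ENNReal.ofReal_lt_top enorm_lt_top)⟩
  let S : Lp ℂ 2 μ →ₗ[ℂ] Lp ℂ 2 ν :=
    { toFun := fun v => (hL v).toLp
      map_add' := fun v w => by
        rw [← MemLp.toLp_add]
        exact MemLp.toLp_congr _ _ (Eventually.of_forall fun y => inner_add_right _ _ _)
      map_smul' := fun c v => by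
        rw [RingHom.id_apply, ← MemLp.toLp_const_smul]
        exact MemLp.toLp_congr _ _ (Eventually.of_forall fun y => inner_smul_right _ _ _) }
  refine ⟨(S.mkContinuous M fun v => ?_).adjoint, fun v => ?_⟩
  · change ‖(hL v).toLp‖ ≤ _
    rw [Lp.norm_toLp]
    refine ENNReal.toReal_le_of_le_ofReal (by positivity) ?_
    rw [ENNReal.ofReal_mul hM, ofReal_norm]
    exact hd v
  · rw [ContinuousLinearMap.adjoint_adjoint]
    exact (hL v).coeFn_toLp

theorem enorm_sq_eq_lintegral (v : Lp ℂ 2 μ) : ‖v‖ₑ ^ (2 : ℝ) = ∫⁻ x, ‖v x‖ₑ ^ (2 : ℝ) ∂μ := by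
  rw [Lp.enorm_def, eLpNorm_eq_lintegral_rpow_enorm_toReal two_ne_zero ENNReal.ofNat_ne_top,
    ENNReal.toReal_ofNat, ← ENNReal.rpow_mul, one_div, inv_mul_cancel₀ two_ne_zero,
    ENNReal.rpow_one]

/-- Cauchy–Schwarz, with the integral restricted to the set that carries w. Keeping only that part
of v is what lets Tonelli bring in the volume of the slices later. -/
theorem enorm_inner_sq_le_of_ae_eq_zero (w v : Lp ℂ 2 μ) {s : Set α} (hs : MeasurableSet s)
    (hw : ∀ᵐ x ∂μ, x ∉ s → w x = 0) :
    ‖⟪w, v⟫_ℂ‖ₑ ^ (2 : ℝ) ≤ ‖w‖ₑ ^ (2 : ℝ) * ∫⁻ x, s.indicator (fun x => ‖v x‖ₑ ^ (2 : ℝ)) x ∂μ := by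
  have hv : AEMeasurable (fun x => s.indicator (fun x => ‖v x‖ₑ) x) μ :=
    (Lp.aestronglyMeasurable v).enorm.indicator hs
  have h1 : ‖⟪w, v⟫_ℂ‖ₑ ≤ ∫⁻ x, ((fun x => ‖w x‖ₑ) * fun x => s.indicator (fun x => ‖v x‖ₑ) x) x ∂μ := by
    rw [L2.inner_def]
    refine (enorm_integral_le_lintegral_enorm _).trans (lintegral_mono_ae ?_)
    filter_upwards [hw] with x hx
    by_cases hxs : x ∈ s
    · rw [Pi.mul_apply, Set.indicator_of_mem hxs, ← enorm_mul, RCLike.inner_apply, enorm_mul,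
        enorm_mul, mul_comm, RCLike.enorm_conj]
    · rw [hx hxs, inner_zero_left]
      simp
  have h2 := h1.trans (ENNReal.lintegral_mul_le_Lp_mul_Lq μ Real.HolderConjugate.two_two
    (Lp.aestronglyMeasurable w).enorm hv)
  refine (ENNReal.rpow_le_rpow h2 zero_le_two).trans ?_
  rw [ENNReal.mul_rpow_of_nonneg _ _ zero_le_two, ← ENNReal.rpow_mul, ← ENNReal.rpow_mul, one_div,
    inv_mul_cancel₀ two_ne_zero, ENNReal.rpow_one, ENNReal.rpow_one, enorm_sq_eq_lintegral w]
  gcongr with x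
  by_cases hxs : x ∈ s
  · simp [hxs]
  · simp [hxs]

/-- Sections that are uniformly bounded and uniformly localized define a bounded operator. -/
theorem eLpNorm_inner_le_of_localized [SFinite μ] [SFinite ν] {d : β → Lp ℂ 2 μ} {ε : ℝ}
    {s : Set (β × α)} (hs : MeasurableSet s) {C : ℝ≥0} (hε : 0 ≤ ε) (hd : ∀ y, ‖d y‖ ≤ ε)
    (hsupp : ∀ y, ∀ᵐ x ∂μ, (y, x) ∉ s → d y x = 0) (hC : ∀ x, ν {y | (y, x) ∈ s} ≤ C)
    (v : Lp ℂ 2 μ) :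
    eLpNorm (fun y => ⟪d y, v⟫_ℂ) 2 ν ≤ ENNReal.ofReal (ε * √C) * ‖v‖ₑ := by
  have hv : AEMeasurable (fun p : β × α => s.indicator (fun p => ‖v p.2‖ₑ ^ (2 : ℝ)) p)
      (ν.prod μ) :=
    (((Lp.aestronglyMeasurable v).enorm.pow_const _).comp_snd).indicator hs
  have key : ∫⁻ y, ‖⟪d y, v⟫_ℂ‖ₑ ^ (2 : ℝ) ∂ν ≤
      ENNReal.ofReal ε ^ (2 : ℝ) * (C * ‖v‖ₑ ^ (2 : ℝ)) := by
    calc ∫⁻ y, ‖⟪d y, v⟫_ℂ‖ₑ ^ (2 : ℝ) ∂ν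
        ≤ ∫⁻ y, ENNReal.ofReal ε ^ (2 : ℝ) *
            ∫⁻ x, s.indicator (fun p => ‖v p.2‖ₑ ^ (2 : ℝ)) (y, x) ∂μ ∂ν := by
          refine lintegral_mono fun y => ?_
          refine (enorm_inner_sq_le_of_ae_eq_zero (d y) v (s := {x | (y, x) ∈ s})
            (measurable_prodMk_left hs) (hsupp y)).trans ?_
          refine mul_le_mul' (ENNReal.rpow_le_rpow ?_ zero_le_two) le_rfl
          rw [← ofReal_norm]
          exact ENNReal.ofReal_le_ofReal (hd y)
      _ = ENNReal.ofReal ε ^ (2 : ℝ) *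
            ∫⁻ x, ∫⁻ y, s.indicator (fun p => ‖v p.2‖ₑ ^ (2 : ℝ)) (y, x) ∂ν ∂μ := by
          rw [lintegral_const_mul'' _ hv.lintegral_prod_right', lintegral_lintegral_swap hv]
      _ ≤ ENNReal.ofReal ε ^ (2 : ℝ) * ∫⁻ x, C * ‖v x‖ₑ ^ (2 : ℝ) ∂μ := by
          refine mul_le_mul' le_rfl (lintegral_mono fun x => ?_)
          have : (fun y => s.indicator (fun p => ‖v p.2‖ₑ ^ (2 : ℝ)) (y, x)) =
              {y | (y, x) ∈ s}.indicator fun _ => ‖v x‖ₑ ^ (2 : ℝ) := by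
            ext y
            by_cases hy : (y, x) ∈ s <;> simp [hy]
          rw [this, lintegral_indicator_const (show MeasurableSet {y | (y, x) ∈ s} from measurable_prodMk_right hs),
            mul_comm]
          exact mul_le_mul' (hC x) le_rfl
      _ = _ := by
          rw [lintegral_const_mul'' _ ((Lp.aestronglyMeasurable v).enorm.pow_const _),
            enorm_sq_eq_lintegral v]
  rw [eLpNorm_eq_lintegral_rpow_enorm_toReal two_ne_zero ENNReal.ofNat_ne_top,
    ENNReal.toReal_ofNat]
  refine (ENNReal.rpow_le_rpow key (by norm_num)).trans (le_of_eq ?_)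
  have h2 : (0 : ℝ) ≤ 1 / 2 := by norm_num
  rw [ENNReal.mul_rpow_of_nonneg _ _ h2, ENNReal.mul_rpow_of_nonneg _ _ h2, ← ENNReal.rpow_mul,
    ← ENNReal.rpow_mul, mul_one_div_cancel two_ne_zero, ENNReal.rpow_one, ENNReal.rpow_one,
    ENNReal.ofReal_mul hε, ← mul_assoc, Real.sqrt_eq_rpow,
    ← ENNReal.ofReal_rpow_of_nonneg C.coe_nonneg h2, ENNReal.ofReal_coe_nnreal]

theorem norm_le_of_ae_bound {f : Lp ℂ 2 μ} {c : ℝ} (hc : 0 ≤ c) {s : Set α}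
    (hs : MeasurableSet s) {C : ℝ≥0}
    (hC : μ s ≤ C) (hf : ∀ᵐ x ∂μ, ‖f x‖ ≤ c) (hfs : ∀ᵐ x ∂μ, x ∉ s → f x = 0) :
    ‖f‖ ≤ c * √C := by
  have key : ∫⁻ x, ‖f x‖ₑ ^ (2 : ℝ) ∂μ ≤ ENNReal.ofReal c ^ (2 : ℝ) * C := by
    calc ∫⁻ x, ‖f x‖ₑ ^ (2 : ℝ) ∂μ ≤ ∫⁻ x, s.indicator (fun _ => ENNReal.ofReal c ^ (2 : ℝ)) x ∂μ := by
          refine lintegral_mono_ae ?_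
          filter_upwards [hf, hfs] with x h1 h2
          by_cases hx : x ∈ s
          · rw [Set.indicator_of_mem hx, ← ofReal_norm]
            gcongr
          · simp [hx, h2 hx]
      _ ≤ _ := by
          rw [lintegral_indicator_const hs]
          gcongr
  have h3 : ‖f‖ₑ ≤ ENNReal.ofReal (c * √C) := by
    rw [Lp.enorm_def, eLpNorm_eq_lintegral_rpow_enorm_toReal two_ne_zero ENNReal.ofNat_ne_top,
      ENNReal.toReal_ofNat]
    refine (ENNReal.rpow_le_rpow key (by norm_num)).trans (le_of_eq ?_)
    have h2 : (0 : ℝ) ≤ 1 / 2 := by norm_num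
    rw [ENNReal.mul_rpow_of_nonneg _ _ h2, ← ENNReal.rpow_mul, mul_one_div_cancel two_ne_zero,
      ENNReal.rpow_one, ENNReal.ofReal_mul hc, Real.sqrt_eq_rpow,
      ← ENNReal.ofReal_rpow_of_nonneg C.coe_nonneg h2, ENNReal.ofReal_coe_nnreal]
  rw [← ofReal_norm] at h3
  exact (ENNReal.ofReal_le_ofReal_iff (by positivity)).1 h3

end Sections

end

section

variable {E : Type*} [NormedAddCommGroup E] [InnerProductSpace ℝ E]
  [MeasurableSpace E] [BorelSpace E]

/-! ### Algebra of multiplication, phase and translation operators. -/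

section Operators

variable (X : Submodule ℝ E) [FiniteDimensional ℝ X]

theorem mulOp_sub (f g : X →ᵇ ℂ) : mulOp X (f - g) = mulOp X f - mulOp X g := by
  ext1 u
  refine Lp.ext ?_
  rw [sub_apply]
  filter_upwards [coeFn_mulOp X (f - g) u, coeFn_mulOp X f u, coeFn_mulOp X g u,
    Lp.coeFn_sub (mulOp X f u) (mulOp X g u)] with x h1 h2 h3 h4
  rw [h1, h4, Pi.sub_apply, h2, h3, BoundedContinuousFunction.sub_apply, sub_mul]

theorem mulOp_mul (f g : X →ᵇ ℂ) : mulOp X (f * g) = mulOp X f ∘L mulOp X g := by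
  ext1 u
  refine Lp.ext ?_
  rw [ContinuousLinearMap.comp_apply]
  filter_upwards [coeFn_mulOp X (f * g) u, coeFn_mulOp X f (mulOp X g u),
    coeFn_mulOp X g u] with x h1 h2 h3
  rw [h1, h2, h3, BoundedContinuousFunction.mul_apply, mul_assoc]

theorem mulOp_one : mulOp X 1 = 1 := by
  ext1 u
  refine Lp.ext ?_
  filter_upwards [coeFn_mulOp X 1 u] with x h1
  rw [h1, BoundedContinuousFunction.coe_one, Pi.one_apply, one_mul]
  rfl

theorem norm_mulOp_le (f : X →ᵇ ℂ) : ‖mulOp X f‖ ≤ ‖f‖ := by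
  refine ContinuousLinearMap.opNorm_le_bound _ (norm_nonneg f) fun u => ?_
  refine Lp.norm_le_mul_norm_of_ae_le_mul ?_
  filter_upwards [coeFn_mulOp X f u] with x h1
  rw [h1, norm_mul]
  gcongr
  exact f.norm_coe_le_norm x

theorem continuous_mulOp : Continuous (mulOp X) := by
  refine LipschitzWith.continuous (K := 1) (LipschitzWith.of_dist_le_mul fun f g => ?_)
  rw [dist_eq_norm, dist_eq_norm, ← mulOp_sub, NNReal.coe_one, one_mul]
  exact norm_mulOp_le X _

theorem adjoint_mulOp (f : X →ᵇ ℂ) : (mulOp X f).adjoint = mulOp X (star f) := by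
  symm
  rw [ContinuousLinearMap.eq_adjoint_iff]
  intro u v
  rw [L2.inner_def, L2.inner_def]
  refine integral_congr_ae ?_
  filter_upwards [coeFn_mulOp X (star f) u, coeFn_mulOp X f v] with x h1 h2
  rw [h1, h2, BoundedContinuousFunction.star_apply, RCLike.inner_apply, RCLike.inner_apply, map_mul,
    RCLike.star_def, RCLike.conj_conj]
  ring

theorem coeFn_adjoint_mulOp (f : X →ᵇ ℂ) (u : HilbertL2 X) :
    (mulOp X f).adjoint u =ᵐ[volume] fun x => (starRingEnd ℂ) (f x) * u x := by
  rw [adjoint_mulOp]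
  exact coeFn_mulOp X (star f) u

theorem planeWave_apply (k : E) (x : X) :
    planeWave X k x = Complex.exp (Complex.I * ((⟪(x : E), k⟫_ℝ : ℝ) : ℂ)) := rfl

theorem planeWave_add (k l : E) : planeWave X (k + l) = planeWave X k * planeWave X l := by
  ext x
  rw [BoundedContinuousFunction.mul_apply, planeWave_apply, planeWave_apply, planeWave_apply,
    ← Complex.exp_add, inner_add_right]
  push_cast
  ring_nf

theorem planeWave_zero : planeWave X (0 : E) = 1 := by
  ext x
  simp [planeWave_apply]

theorem star_planeWave (k : E) : star (planeWave X k) = planeWave X (-k) := by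
  ext x
  rw [BoundedContinuousFunction.star_apply, planeWave_apply, planeWave_apply, inner_neg_right,
    RCLike.star_def, ← Complex.exp_conj]
  simp

theorem phaseOp_add (k l : E) : phaseOp X (k + l) = phaseOp X k ∘L phaseOp X l := by
  rw [phaseOp, planeWave_add, mulOp_mul]; rfl

theorem phaseOp_zero : phaseOp X (0 : E) = 1 := by
  rw [phaseOp, planeWave_zero, mulOp_one]

theorem adjoint_phaseOp (k : E) : (phaseOp X k).adjoint = phaseOp X (-k) := by
  rw [phaseOp, adjoint_mulOp, star_planeWave]; rfl

theorem phaseOp_comp_neg (k : E) : phaseOp X k ∘L phaseOp X (-k) = 1 := by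
  rw [← phaseOp_add, add_neg_cancel, phaseOp_zero]

theorem phaseOp_neg_comp (k : E) : phaseOp X (-k) ∘L phaseOp X k = 1 := by
  rw [← phaseOp_add, neg_add_cancel, phaseOp_zero]

theorem norm_phaseOp_le (k : E) : ‖phaseOp X k‖ ≤ 1 := by
  refine (norm_mulOp_le X _).trans ?_
  refine (BoundedContinuousFunction.norm_le zero_le_one).2 fun x => ?_
  rw [planeWave_apply, mul_comm, Complex.norm_exp_ofReal_mul_I]

theorem coeFn_phaseOp (k : E) (u : HilbertL2 X) : phaseOp X k u =ᵐ[volume]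
    fun x => Complex.exp (Complex.I * ((⟪(x : E), k⟫_ℝ : ℝ) : ℂ)) * u x :=
  coeFn_mulOp X _ u

theorem translOp_add (a b : X) : translOp X (a + b) = translOp X a ∘L translOp X b := by
  ext1 u
  refine Lp.ext ?_
  rw [ContinuousLinearMap.comp_apply]
  filter_upwards [coeFn_translOp X (a + b) u, coeFn_translOp X a (translOp X b u),
    (measurePreserving_add_right volume a).quasiMeasurePreserving.ae (coeFn_translOp X b u)]
    with x h1 h2 h3
  rw [h1, h2, h3, add_assoc]

theorem translOp_zero : translOp X 0 = 1 := by
  ext1 u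
  refine Lp.ext ?_
  filter_upwards [coeFn_translOp X 0 u] with x h1
  rw [h1, add_zero]
  rfl

theorem norm_translOp_le (a : X) : ‖translOp X a‖ ≤ 1 :=
  LinearIsometry.norm_toContinuousLinearMap_le _

theorem translOp_comp_neg (a : X) : translOp X a ∘L translOp X (-a) = 1 := by
  rw [← translOp_add, add_neg_cancel, translOp_zero]

theorem translOp_neg_comp (a : X) : translOp X (-a) ∘L translOp X a = 1 := by
  rw [← translOp_add, neg_add_cancel, translOp_zero]

theorem adjoint_translOp (a : X) : (translOp X a).adjoint = translOp X (-a) := by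
  have h : (translOp X a).adjoint ∘L translOp X a = 1 := by
    ext1 u
    refine ext_inner_right ℂ fun v => ?_
    rw [ContinuousLinearMap.comp_apply, ContinuousLinearMap.adjoint_inner_left]
    exact LinearIsometry.inner_map_map _ u v
  calc (translOp X a).adjoint
      = ((translOp X a).adjoint ∘L translOp X a) ∘L translOp X (-a) := by
        rw [ContinuousLinearMap.comp_assoc, translOp_comp_neg]; rfl
    _ = _ := by rw [h]; rfl

theorem HasSections.comp_mulOp {α : Type*} [MeasurableSpace α] {μ : Measure α}
    {T : HilbertL2 X →L[ℂ] Lp ℂ 2 μ} {d : X → Lp ℂ 2 μ} (h : HasSections T d) (f : X →ᵇ ℂ) :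
    HasSections (T ∘L mulOp X f) fun y => f y • d y := by
  intro v
  rw [ContinuousLinearMap.adjoint_comp]
  filter_upwards [coeFn_adjoint_mulOp X f (T.adjoint v), h v] with y h1 h2
  rw [ContinuousLinearMap.comp_apply, h1, h2, inner_smul_left]

end Operators

end

section

variable {E : Type*} [NormedAddCommGroup E] [InnerProductSpace ℝ E]
  [MeasurableSpace E] [BorelSpace E]

/-! ### The operators T_{XY}(φ): columns, norm bounds and dependence on φ. -/

section Convolution

/-- The volume of a ball of radius `D` in `X`. -/
def ballVol (X : Submodule ℝ E) [FiniteDimensional ℝ X] (D : ℝ) : ℝ≥0 :=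
  (volume (Metric.closedBall (0 : X) D)).toNNReal

/-- Such a set lies in the closed ball of radius D about any of its points, and the volume is
translation invariant. -/
theorem volume_le_ballVol (X : Submodule ℝ E) [FiniteDimensional ℝ X] {s : Set X} {D : ℝ}
    (hs : ∀ a ∈ s, ∀ b ∈ s, ‖a - b‖ ≤ D) : volume s ≤ ballVol X D := by
  rw [ballVol, ENNReal.coe_toNNReal measure_closedBall_lt_top.ne]
  rcases s.eq_empty_or_nonempty with rfl | ⟨a, ha⟩
  · simp
  · rw [← Measure.addHaar_closedBall_center volume a D]
    refine measure_mono fun b hb => ?_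
    rw [Metric.mem_closedBall, dist_eq_norm]
    exact hs b hb a ha

variable {X Y G : Submodule ℝ E} [FiniteDimensional ℝ X] [FiniteDimensional ℝ Y]
  [FiniteDimensional ℝ G]

theorem isometry_inclusion (hX : X ≤ G) : Isometry (Submodule.inclusion hX) :=
  AddMonoidHomClass.isometry_of_norm _ fun _ => rfl

theorem isClosedEmbedding_inclusion_sub (hX : X ≤ G) (g : G) :
    IsClosedEmbedding fun x : X => Submodule.inclusion hX x - g :=
  (Homeomorph.subRight g).isClosedEmbedding.comp
    (isometry_inclusion hX).isClosedEmbedding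

theorem hasCompactSupport_comp_inclusion_sub (hX : X ≤ G) (φ : C_c(G, ℂ)) (g : G) :
    HasCompactSupport fun x : X => φ (Submodule.inclusion hX x - g) :=
  φ.hasCompactSupport.comp_isClosedEmbedding (isClosedEmbedding_inclusion_sub hX g)

theorem continuous_comp_inclusion_sub (hX : X ≤ G) (φ : C_c(G, ℂ)) (g : G) :
    Continuous fun x : X => φ (Submodule.inclusion hX x - g) :=
  φ.continuous.comp (isClosedEmbedding_inclusion_sub hX g).continuous

/-- The function `x ↦ φ(x - y)` as an element of `L²(X)`. -/
def convSection (hX : X ≤ G) (hY : Y ≤ G) (φ : C_c(G, ℂ)) (y : Y) : HilbertL2 X :=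
  ((continuous_comp_inclusion_sub hX φ (Submodule.inclusion hY y)).memLp_of_hasCompactSupport
    (hasCompactSupport_comp_inclusion_sub hX φ (Submodule.inclusion hY y))).toLp

theorem coeFn_convSection (hX : X ≤ G) (hY : Y ≤ G) (φ : C_c(G, ℂ)) (y : Y) :
    convSection hX hY φ y =ᵐ[volume]
      fun x => φ (Submodule.inclusion hX x - Submodule.inclusion hY y) :=
  MemLp.coeFn_toLp _

theorem exists_bound_support (φ : C_c(G, ℂ)) :
    ∃ c R : ℝ, 0 ≤ c ∧ 0 ≤ R ∧ (∀ v, ‖φ v‖ ≤ c) ∧ ∀ v, R < ‖v‖ → φ v = 0 := by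
  obtain ⟨c, hc⟩ := φ.hasCompactSupport.exists_bound_of_continuous φ.continuous
  obtain ⟨R, hR⟩ := φ.hasCompactSupport.isCompact.isBounded.exists_norm_le
  refine ⟨c, max R 0, (norm_nonneg _).trans (hc 0), le_max_right _ _, hc, fun v hv => ?_⟩
  by_contra h
  exact absurd (hR v (subset_tsupport _ h)) (not_le.2 ((le_max_left _ _).trans_lt hv))

theorem measurableSet_norm_sub_le (hX : X ≤ G) (hY : Y ≤ G) (R : ℝ) :
    MeasurableSet {p : Y × X | ‖Submodule.inclusion hX p.2 - Submodule.inclusion hY p.1‖ ≤ R} := by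
  have h1 := (isometry_inclusion hX).continuous
  have h2 := (isometry_inclusion hY).continuous
  exact (isClosed_le ((h1.comp continuous_snd).sub (h2.comp continuous_fst)).norm continuous_const).measurableSet

theorem volume_norm_sub_le (hX : X ≤ G) (g : G) (R : ℝ) :
    volume {x : X | ‖Submodule.inclusion hX x - g‖ ≤ R} ≤ ballVol X (2 * R) := by
  refine volume_le_ballVol X fun a ha b hb => ?_
  have h : ‖a - b‖ = ‖(Submodule.inclusion hX a - g) - (Submodule.inclusion hX b - g)‖ := by
    rw [sub_sub_sub_cancel_right, ← map_sub]; rfl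
  rw [h, two_mul]
  exact (norm_sub_le _ _).trans (add_le_add ha hb)

/-- Both columns vanish outside the part of X within R + ‖y - y'‖ of y, so a uniform bound on the
difference becomes an L² bound. -/
theorem norm_convSection_sub_le (hX : X ≤ G) (hY : Y ≤ G) (φ ψ : C_c(G, ℂ)) (y y' : Y)
    {c R : ℝ} (hc : 0 ≤ c)
    (hφ : ∀ x : X, ‖φ (Submodule.inclusion hX x - Submodule.inclusion hY y) -
      ψ (Submodule.inclusion hX x - Submodule.inclusion hY y')‖ ≤ c)
    (hR : ∀ v, R < ‖v‖ → φ v = 0 ∧ ψ v = 0) :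
    ‖convSection hX hY φ y - convSection hX hY ψ y'‖ ≤ c * √(ballVol X (2 * (R + ‖y - y'‖))) := by
  refine norm_le_of_ae_bound hc (s := {x : X | ‖Submodule.inclusion hX x -
    Submodule.inclusion hY y‖ ≤ R + ‖y - y'‖}) ?_ (volume_norm_sub_le hX _ _) ?_ ?_
  · exact measurable_prodMk_left (measurableSet_norm_sub_le hX hY (R + ‖y - y'‖))
  · filter_upwards [coeFn_convSection hX hY φ y, coeFn_convSection hX hY ψ y',
      Lp.coeFn_sub (convSection hX hY φ y) (convSection hX hY ψ y')] with x h1 h2 h3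
    rw [h3, Pi.sub_apply, h1, h2]
    exact hφ x
  · filter_upwards [coeFn_convSection hX hY φ y, coeFn_convSection hX hY ψ y',
      Lp.coeFn_sub (convSection hX hY φ y) (convSection hX hY ψ y')] with x h1 h2 h3 hx
    replace hx := not_le.1 hx
    have hn := norm_nonneg (y - y')
    have h4 : ‖Submodule.inclusion hX x - Submodule.inclusion hY y‖ ≤
        ‖Submodule.inclusion hX x - Submodule.inclusion hY y'‖ + ‖y - y'‖ := by
      have : Submodule.inclusion hX x - Submodule.inclusion hY y =
        (Submodule.inclusion hX x - Submodule.inclusion hY y') -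
          Submodule.inclusion hY (y - y') := by rw [map_sub]; abel
      rw [this]
      exact norm_sub_le _ _
    rw [h3, Pi.sub_apply, h1, h2, (hR _ (by linarith)).1, (hR _ (by linarith)).2, sub_zero]

theorem norm_convSection_le (hX : X ≤ G) (hY : Y ≤ G) (φ : C_c(G, ℂ)) (y : Y)
    {c R : ℝ} (hc : 0 ≤ c) (hφ : ∀ v, ‖φ v‖ ≤ c) (hR : ∀ v, R < ‖v‖ → φ v = 0) :
    ‖convSection hX hY φ y‖ ≤ c * √(ballVol X (2 * R)) := by
  have h0 : convSection hX hY 0 y = 0 := by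
    refine Lp.ext ?_
    filter_upwards [coeFn_convSection hX hY 0 y, Lp.coeFn_zero ℂ 2 volume] with x h1 h2
    rw [h1, h2]; rfl
  have h := norm_convSection_sub_le hX hY φ 0 y y hc (R := R)
    (fun x => by simpa using hφ _) (fun v hv => ⟨hR v hv, rfl⟩)
  simpa [h0] using h

theorem continuous_convSection (hX : X ≤ G) (hY : Y ≤ G) (φ : C_c(G, ℂ)) :
    Continuous (convSection hX hY φ) := by
  obtain ⟨-, R, -, hR0, -, hR⟩ := exists_bound_support φ
  have hu := φ.hasCompactSupport.uniformContinuous_of_continuous φ.continuous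
  rw [Metric.uniformContinuous_iff] at hu
  rw [Metric.continuous_iff]
  intro y ε hε
  set K := √(ballVol X (2 * (R + 1)))
  have hK0 : 0 ≤ K := Real.sqrt_nonneg _
  obtain ⟨δ, hδ, hφ⟩ := hu (ε / (K + 1)) (by positivity)
  -- The bound ‖y' - y‖ < 1 keeps the volume factor below the fixed constant K.
  refine ⟨min δ 1, by positivity, fun y' hy' => ?_⟩
  rw [dist_eq_norm] at hy' ⊢
  have hK : √(ballVol X (2 * (R + ‖y' - y‖))) ≤ K := by
    refine Real.sqrt_le_sqrt (NNReal.coe_le_coe.2 ?_)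
    refine ENNReal.toNNReal_mono measure_closedBall_lt_top.ne
      (measure_mono (Metric.closedBall_subset_closedBall ?_))
    have := (hy'.trans_le (min_le_right _ _)).le
    linarith
  refine (norm_convSection_sub_le hX hY φ φ y' y (c := ε / (K + 1)) (by positivity)
    (fun x => ?_) fun v hv => ⟨hR v hv, hR v hv⟩).trans_lt ?_
  · rw [← dist_eq_norm]
    refine (hφ ?_).le
    rw [dist_eq_norm, sub_sub_sub_cancel_left, ← map_sub, ← norm_neg, ← map_neg, neg_sub]
    exact hy'.trans_le (min_le_left _ _)
  · calc _ ≤ ε / (K + 1) * K := by gcongr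
      _ < ε / (K + 1) * (K + 1) := by gcongr; linarith
      _ = ε := div_mul_cancel₀ _ (by positivity)

theorem convSection_eq_zero_of_lt (hX : X ≤ G) (hY : Y ≤ G) {φ : C_c(G, ℂ)} {R : ℝ}
    (hR : ∀ v, R < ‖v‖ → φ v = 0) (y : Y) :
    ∀ᵐ x, (y, x) ∉ {p : Y × X | ‖Submodule.inclusion hX p.2 - Submodule.inclusion hY p.1‖ ≤ R} →
      convSection hX hY φ y x = 0 := by
  filter_upwards [coeFn_convSection hX hY φ y] with x h1 hx
  rw [h1, hR _ (not_le.1 hx)]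

theorem eLpNorm_inner_convSection_le (hX : X ≤ G) (hY : Y ≤ G) (φ : C_c(G, ℂ))
    {c R : ℝ} (hc : 0 ≤ c) (hφ : ∀ v, ‖φ v‖ ≤ c) (hR : ∀ v, R < ‖v‖ → φ v = 0) (v : HilbertL2 X) :
    eLpNorm (fun y => ⟪convSection hX hY φ y, v⟫_ℂ) 2 volume ≤
      ENNReal.ofReal (c * √(ballVol X (2 * R)) * √(ballVol Y (2 * R))) * ‖v‖ₑ := by
  refine eLpNorm_inner_le_of_localized (measurableSet_norm_sub_le hX hY R) (by positivity)
    (fun y => norm_convSection_le hX hY φ y hc hφ hR) (convSection_eq_zero_of_lt hX hY hR)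
    (fun x => ?_) v
  refine le_of_eq_of_le (congrArg _ ?_) (volume_norm_sub_le hY (Submodule.inclusion hX x) R)
  ext y
  change ‖Submodule.inclusion hX x - Submodule.inclusion hY y‖ ≤ R ↔
    ‖Submodule.inclusion hY y - Submodule.inclusion hX x‖ ≤ R
  rw [norm_sub_rev]

theorem exists_hasSections_convSection (hX : X ≤ G) (hY : Y ≤ G) (φ : C_c(G, ℂ)) :
    ∃ T : HilbertL2 Y →L[ℂ] HilbertL2 X, HasSections T (convSection hX hY φ) := by
  obtain ⟨c, R, hc, hR0, hφ, hR⟩ := exists_bound_support φ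
  exact exists_hasSections
    (fun v => ((continuous_convSection hX hY φ).inner continuous_const).aestronglyMeasurable)
    (by positivity) (eLpNorm_inner_convSection_le hX hY φ hc hφ hR)

/-- `T` is the operator `T_{XY}(φ)`. -/
def IsConv (hX : X ≤ G) (hY : Y ≤ G) (φ : G → ℂ) (T : HilbertL2 Y →L[ℂ] HilbertL2 X) : Prop :=
  ∀ u : HilbertL2 Y, T u =ᵐ[volume]
    fun x => ∫ y : Y, φ (Submodule.inclusion hX x - Submodule.inclusion hY y) * u y

/-- The function `v ↦ conj (φ(-v))`. -/
def reflect (φ : C_c(G, ℂ)) : C_c(G, ℂ) :=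
  ⟨⟨fun v => (starRingEnd ℂ) (φ (-v)),
    Complex.continuous_conj.comp (φ.continuous.comp continuous_neg)⟩,
    (φ.hasCompactSupport.comp_homeomorph (Homeomorph.neg G)).comp_left (map_zero _)⟩

theorem reflect_apply (φ : C_c(G, ℂ)) (v : G) : reflect φ v = (starRingEnd ℂ) (φ (-v)) := rfl

theorem inner_convSection_reflect_ae (hX : X ≤ G) (hY : Y ≤ G) (φ : C_c(G, ℂ)) (x : X)
    (u : HilbertL2 Y) : (fun y => ⟪convSection hY hX (reflect φ) x y, u y⟫_ℂ) =ᵐ[volume]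
      fun y => φ (Submodule.inclusion hX x - Submodule.inclusion hY y) * u y := by
  filter_upwards [coeFn_convSection hY hX (reflect φ) x] with y h1
  rw [h1, reflect_apply, RCLike.inner_apply, RCLike.conj_conj, neg_sub, mul_comm]

theorem inner_convSection_reflect (hX : X ≤ G) (hY : Y ≤ G) (φ : C_c(G, ℂ)) (x : X)
    (u : HilbertL2 Y) : ⟪convSection hY hX (reflect φ) x, u⟫_ℂ =
      ∫ y : Y, φ (Submodule.inclusion hX x - Submodule.inclusion hY y) * u y := by
  rw [L2.inner_def]
  exact integral_congr_ae (inner_convSection_reflect_ae hX hY φ x u)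

theorem integrable_conv (hX : X ≤ G) (hY : Y ≤ G) (φ : C_c(G, ℂ)) (x : X) (u : HilbertL2 Y) :
    Integrable fun y : Y => φ (Submodule.inclusion hX x - Submodule.inclusion hY y) * u y :=
  (L2.integrable_inner (𝕜 := ℂ) (convSection hY hX (reflect φ) x) u).congr
    (inner_convSection_reflect_ae hX hY φ x u)

/-- The value of T_{XY}(φ)u at x is the inner product of u with the column at x of the reflected
function, so the rows of T are the columns of its adjoint. -/
theorem isConv_iff (hX : X ≤ G) (hY : Y ≤ G) (φ : C_c(G, ℂ))
    (T : HilbertL2 Y →L[ℂ] HilbertL2 X) :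
    IsConv hX hY φ T ↔ HasSections T.adjoint (convSection hY hX (reflect φ)) := by
  simp only [IsConv, HasSections, ContinuousLinearMap.adjoint_adjoint, inner_convSection_reflect]

theorem exists_isConv (hX : X ≤ G) (hY : Y ≤ G) (φ : C_c(G, ℂ)) : ∃ T, IsConv hX hY φ T := by
  obtain ⟨T, hT⟩ := exists_hasSections_convSection hY hX (reflect φ)
  refine ⟨T.adjoint, ?_⟩
  rwa [isConv_iff, ContinuousLinearMap.adjoint_adjoint]

theorem IsConv.norm_le {hX : X ≤ G} {hY : Y ≤ G} {φ : C_c(G, ℂ)}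
    {T : HilbertL2 Y →L[ℂ] HilbertL2 X} (h : IsConv hX hY φ T) {c R : ℝ} (hc : 0 ≤ c)
    (hφ : ∀ v, ‖φ v‖ ≤ c) (hR : ∀ v, R < ‖v‖ → φ v = 0) :
    ‖T‖ ≤ c * √(ballVol Y (2 * R)) * √(ballVol X (2 * R)) := by
  rw [isConv_iff] at h
  rw [← LinearIsometryEquiv.norm_map ContinuousLinearMap.adjoint T]
  refine h.norm_le (by positivity) (eLpNorm_inner_convSection_le hY hX (reflect φ) hc ?_ ?_)
  · intro v
    rw [reflect_apply, RCLike.norm_conj]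
    exact hφ _
  · intro v hv
    rw [reflect_apply, hR _ (by rwa [norm_neg]), map_zero]

theorem IsConv.sub {hX : X ≤ G} {hY : Y ≤ G} {φ ψ : C_c(G, ℂ)}
    {T S : HilbertL2 Y →L[ℂ] HilbertL2 X} (hT : IsConv hX hY φ T) (hS : IsConv hX hY ψ S) :
    IsConv hX hY (φ - ψ : C_c(G, ℂ)) (T - S) := by
  intro u
  filter_upwards [hT u, hS u, Lp.coeFn_sub (T u) (S u)] with x h1 h2 h3
  rw [sub_apply, h3, Pi.sub_apply, h1, h2,
    ← integral_sub (integrable_conv hX hY φ x u) (integrable_conv hX hY ψ x u)]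
  simp only [CompactlySupportedContinuousMap.sub_apply, sub_mul]

/-- The function `v ↦ φ(v + a)`. -/
def shift (φ : C_c(G, ℂ)) (a : G) : C_c(G, ℂ) :=
  ⟨⟨fun v => φ (v + a), φ.continuous.comp (continuous_add_const a)⟩,
    φ.hasCompactSupport.comp_homeomorph (Homeomorph.addRight a)⟩

theorem shift_apply (φ : C_c(G, ℂ)) (a v : G) : shift φ a v = φ (v + a) := rfl

/-- The function `v ↦ exp(i⟨v, k⟩) φ(v)`. -/
def modulate (φ : C_c(G, ℂ)) (k : E) : C_c(G, ℂ) :=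
  ⟨⟨fun v => planeWave G k v * φ v, (planeWave G k).continuous.mul φ.continuous⟩,
    φ.hasCompactSupport.mul_left⟩

theorem modulate_apply (φ : C_c(G, ℂ)) (k : E) (v : G) :
    modulate φ k v = planeWave G k v * φ v := rfl

theorem IsConv.translOp_comp {hX : X ≤ G} {hY : Y ≤ G} {φ : C_c(G, ℂ)}
    {T : HilbertL2 Y →L[ℂ] HilbertL2 X} (hT : IsConv hX hY φ T) (a : X) :
    IsConv hX hY (shift φ (Submodule.inclusion hX a)) (translOp X a ∘L T) := by
  intro u
  rw [ContinuousLinearMap.comp_apply]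
  filter_upwards [coeFn_translOp X a (T u),
    (measurePreserving_add_right volume a).quasiMeasurePreserving.ae (hT u)] with x h1 h2
  rw [h1, h2]
  refine integral_congr_ae (Eventually.of_forall fun y => ?_)
  simp only [shift_apply, map_add, sub_add_eq_add_sub]

theorem IsConv.comp_translOp {hX : X ≤ G} {hY : Y ≤ G} {φ : C_c(G, ℂ)}
    {T : HilbertL2 Y →L[ℂ] HilbertL2 X} (hT : IsConv hX hY φ T) (a : Y) :
    IsConv hX hY (shift φ (Submodule.inclusion hY a)) (T ∘L translOp Y a) := by
  intro u
  rw [ContinuousLinearMap.comp_apply]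
  filter_upwards [hT (translOp Y a u)] with x h1
  rw [h1, ← integral_add_right_eq_self (fun y : Y => shift φ (Submodule.inclusion hY a)
    (Submodule.inclusion hX x - Submodule.inclusion hY y) * u y) a]
  refine integral_congr_ae ?_
  filter_upwards [coeFn_translOp Y a u] with y h2
  rw [h2, shift_apply, map_add (Submodule.inclusion hY), sub_add_eq_sub_sub, sub_add_cancel]

/-- The phases at x and y combine to exp(i⟨x - y, k⟩), which is again a function of x - y. -/
theorem IsConv.phaseOp_comp {hX : X ≤ G} {hY : Y ≤ G} {φ : C_c(G, ℂ)}
    {T : HilbertL2 Y →L[ℂ] HilbertL2 X} (hT : IsConv hX hY φ T) (k : E) :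
    IsConv hX hY (modulate φ k) (phaseOp X k ∘L T ∘L phaseOp Y (-k)) := by
  intro u
  rw [ContinuousLinearMap.comp_apply, ContinuousLinearMap.comp_apply]
  filter_upwards [coeFn_phaseOp X k (T (phaseOp Y (-k) u)), hT (phaseOp Y (-k) u)] with x h1 h2
  rw [h1, h2, ← integral_const_mul]
  refine integral_congr_ae ?_
  filter_upwards [coeFn_phaseOp Y (-k) u] with y h3
  rw [h3, modulate_apply, planeWave_apply]
  have : Complex.exp (Complex.I * ((⟪((Submodule.inclusion hX x - Submodule.inclusion hY y : G) : E),
      k⟫_ℝ : ℝ) : ℂ)) = Complex.exp (Complex.I * ((⟪(x : E), k⟫_ℝ : ℝ) : ℂ)) *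
      Complex.exp (Complex.I * ((⟪(y : E), -k⟫_ℝ : ℝ) : ℂ)) := by
    rw [← Complex.exp_add, ← mul_add, ← Complex.ofReal_add, inner_neg_right, ← sub_eq_add_neg,
      ← inner_sub_left]
    rfl
  rw [this]
  ring

/-- `T_{XY}(φ)` depends continuously on `φ`, for uniformly bounded supports. -/
theorem tendsto_norm_sub_of_isConv {ι : Type*} {l : Filter ι} {hX : X ≤ G} {hY : Y ≤ G}
    {φ : C_c(G, ℂ)} {ψ : ι → C_c(G, ℂ)} {T : HilbertL2 Y →L[ℂ] HilbertL2 X}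
    {S : ι → HilbertL2 Y →L[ℂ] HilbertL2 X} (hT : IsConv hX hY φ T)
    (hS : ∀ i, IsConv hX hY (ψ i) (S i)) {R : ℝ} (hφ : ∀ v, R < ‖v‖ → φ v = 0)
    (hψ : ∀ᶠ i in l, ∀ v, R < ‖v‖ → ψ i v = 0)
    (hψφ : ∀ ε > 0, ∀ᶠ i in l, ∀ v, ‖ψ i v - φ v‖ ≤ ε) :
    Tendsto (fun i => ‖S i - T‖) l (𝓝 0) := by
  set K := √(ballVol Y (2 * R)) * √(ballVol X (2 * R))
  have hK : 0 ≤ K := by positivity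
  refine tendsto_order.2 ⟨fun a ha => Eventually.of_forall fun i => ha.trans_le (norm_nonneg _),
    fun ε hε => ?_⟩
  filter_upwards [hψ, hψφ (ε / (K + 1)) (by positivity)] with i h1 h2
  have h3 := ((hS i).sub hT).norm_le (c := ε / (K + 1)) (R := R) (by positivity) h2
    (fun v hv => by rw [CompactlySupportedContinuousMap.sub_apply, h1 v hv, hφ v hv, sub_zero])
  calc _ ≤ ε / (K + 1) * K := by rw [← mul_assoc]; exact h3
    _ < ε / (K + 1) * (K + 1) := by gcongr; linarith
    _ = ε := div_mul_cancel₀ _ (by positivity)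

theorem eventually_shift {ι : Type*} {l : Filter ι} (φ : C_c(G, ℂ)) {a : ι → G}
    (ha : Tendsto a l (𝓝 0)) {ε : ℝ} (hε : 0 < ε) :
    ∀ᶠ i in l, ∀ v, ‖shift φ (a i) v - φ v‖ ≤ ε := by
  have hu := φ.hasCompactSupport.uniformContinuous_of_continuous φ.continuous
  rw [Metric.uniformContinuous_iff] at hu
  obtain ⟨δ, hδ, h⟩ := hu ε hε
  filter_upwards [ha (Metric.ball_mem_nhds 0 hδ)] with i hi v
  rw [← dist_eq_norm, shift_apply]
  refine (h ?_).le
  rw [dist_eq_norm, add_sub_cancel_left]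
  simpa using hi

theorem tendsto_norm_sub_of_shift {ι : Type*} {l : Filter ι} {hX : X ≤ G} {hY : Y ≤ G}
    {φ : C_c(G, ℂ)} {T : HilbertL2 Y →L[ℂ] HilbertL2 X} (hT : IsConv hX hY φ T)
    {S : ι → HilbertL2 Y →L[ℂ] HilbertL2 X} {a : ι → G} (ha : Tendsto a l (𝓝 0))
    (hS : ∀ i, IsConv hX hY (shift φ (a i)) (S i)) :
    Tendsto (fun i => ‖S i - T‖) l (𝓝 0) := by
  obtain ⟨-, R, -, hR0, -, hR⟩ := exists_bound_support φ
  -- Shifts of norm below 1 enlarge the support radius by at most 1, so one radius serves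
  -- eventually.
  refine tendsto_norm_sub_of_isConv hT hS (R := R + 1) (fun v hv => hR v (by linarith)) ?_
    fun ε hε => eventually_shift φ ha hε
  filter_upwards [ha (Metric.ball_mem_nhds 0 one_pos)] with i hi v hv
  rw [shift_apply]
  refine hR _ ?_
  have h1 : ‖a i‖ < 1 := by simpa using hi
  have h2 := norm_sub_le (v + a i) (a i)
  rw [add_sub_cancel_right] at h2
  linarith

theorem norm_planeWave_sub_one_le (X : Submodule ℝ E) [FiniteDimensional ℝ X] (k : E) (x : X) :
    ‖planeWave X k x - 1‖ ≤ ‖x‖ * ‖k‖ := by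
  rw [planeWave_apply]
  refine (Real.norm_exp_I_mul_ofReal_sub_one_le).trans ?_
  exact norm_inner_le_norm (𝕜 := ℝ) (x : E) k

theorem IsConv.tendsto_phaseOp {ι : Type*} {l : Filter ι} {hX : X ≤ G} {hY : Y ≤ G}
    {φ : C_c(G, ℂ)} {T : HilbertL2 Y →L[ℂ] HilbertL2 X} (hT : IsConv hX hY φ T)
    {k : ι → E} (hk : Tendsto k l (𝓝 0)) :
    Tendsto (fun i => ‖phaseOp X (k i) ∘L T ∘L phaseOp Y (-k i) - T‖) l (𝓝 0) := by
  obtain ⟨c, R, hc, hR0, hφ, hR⟩ := exists_bound_support φ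
  refine tendsto_norm_sub_of_isConv hT (fun i => hT.phaseOp_comp (k i)) (R := R) hR
    (Eventually.of_forall fun i v hv => by rw [modulate_apply, hR v hv, mul_zero]) fun ε hε => ?_
  filter_upwards [hk (Metric.ball_mem_nhds 0 (show 0 < ε / (R * c + 1) by positivity))] with i hi v
  have hi' : ‖k i‖ < ε / (R * c + 1) := by simpa using hi
  rw [modulate_apply, ← sub_one_mul, norm_mul]
  by_cases hv : R < ‖v‖
  · rw [hR v hv, norm_zero, mul_zero]; exact hε.le
  · calc _ ≤ (‖v‖ * ‖k i‖) * c := by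
          gcongr
          exacts [norm_planeWave_sub_one_le G _ v, hφ v]
      _ ≤ (R * (ε / (R * c + 1))) * c := by gcongr; exact not_lt.1 hv
      _ = ε * (R * c / (R * c + 1)) := by ring
      _ ≤ ε * 1 := by
        gcongr
        rw [div_le_one (by positivity)]
        linarith
      _ = ε := mul_one ε

end Convolution

end

section

/-! ### Fourier cutoffs and concentration of dilated averages. -/

section FourierCutoff

open scoped FourierTransform ContDiff

/-- There is an integrable function on `W` whose Fourier transform is compactly supported and
equal to `1` at the origin. -/
theorem exists_integrable_fourier_compactSupport (W : Type*) [NormedAddCommGroup W]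
    [InnerProductSpace ℝ W] [FiniteDimensional ℝ W] [MeasurableSpace W] [BorelSpace W] :
    ∃ θ : W → ℂ, Integrable θ ∧ ∃ χ : C_c(W, ℂ), χ 0 = 1 ∧
      ∀ w : W, ∫ z, θ z * Complex.exp (Complex.I * ((⟪w, z⟫_ℝ : ℝ) : ℂ)) = χ w := by
  let b : ContDiffBump (0 : W) := ⟨1, 2, one_pos, one_lt_two⟩
  have hsm : ContDiff ℝ ∞ fun w => (b w : ℂ) := Complex.ofRealCLM.contDiff.comp b.contDiff
  have hcs : HasCompactSupport fun w => (b w : ℂ) := b.hasCompactSupport.comp_left (g := Complex.ofReal) Complex.ofReal_zero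
  obtain ⟨f, hf⟩ : ∃ f : SchwartzMap W ℂ, ∀ w, f w = b w := ⟨hcs.toSchwartzMap hsm, fun w => rfl⟩
  -- The inverse Fourier transform carries exp(2πi⟨z, w⟩); rescaling the bump by (2π)⁻¹ gives the
  -- plain phase exp(i⟨w, z⟩).
  have h2π : (2 * Real.pi)⁻¹ ≠ 0 := by positivity
  have hχc : Continuous fun w : W => (b ((2 * Real.pi)⁻¹ • w) : ℂ) :=
    hsm.continuous.comp (continuous_const_smul _)
  have hχs : HasCompactSupport fun w : W => (b ((2 * Real.pi)⁻¹ • w) : ℂ) :=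
    hcs.comp_homeomorph (Homeomorph.smulOfNeZero _ h2π)
  obtain ⟨χ, hχ⟩ : ∃ χ : C_c(W, ℂ), ∀ w, χ w = (b ((2 * Real.pi)⁻¹ • w) : ℂ) :=
    ⟨⟨⟨_, hχc⟩, hχs⟩, fun w => rfl⟩
  obtain ⟨g, hg⟩ : ∃ g : SchwartzMap W ℂ, g = 𝓕 f := ⟨_, rfl⟩
  refine ⟨g, g.integrable, χ, ?_, fun w => ?_⟩
  · rw [hχ, smul_zero]
    exact_mod_cast b.one_of_mem_closedBall (by simp [b])
  · have hinv : (𝓕⁻ g : SchwartzMap W ℂ) = f := by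
      rw [hg]
      exact FourierTransform.fourierInv_fourier_eq f
    rw [hχ, ← hf, ← hinv, SchwartzMap.fourierInv_coe, Real.fourierInv_eq']
    refine integral_congr_ae (Eventually.of_forall fun z => ?_)
    simp only [smul_eq_mul]
    rw [mul_comm, real_inner_smul_right, real_inner_comm z w]
    congr 2
    rw [mul_comm, mul_inv_cancel_left₀ (by positivity)]

/-- Averages with respect to dilated integrable weights concentrate at the origin. -/
theorem exists_dilation_norm_integral_le {W : Type*} [NormedAddCommGroup W]
    [NormedSpace ℝ W] [MeasurableSpace W] [BorelSpace W] {μ : Measure W} {θ : W → ℂ}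
    (hθ : Integrable θ μ) {N : W → ℝ} (hN : Tendsto N (𝓝 0) (𝓝 0)) {C : ℝ} (hC : ∀ z, N z ≤ C)
    {η : ℝ} (hη : 0 < η) :
    ∃ ε : ℝ, 0 < ε ∧ ∀ (f : W → ℂ) (c : ℝ), 0 ≤ c → (∀ z, ‖f z‖ ≤ N (ε • z) * c) →
      ‖∫ z, θ z * f z ∂μ‖ ≤ η * c := by
  set I := ∫ z, ‖θ z‖ ∂μ
  have hI : 0 ≤ I := integral_nonneg fun z => norm_nonneg _
  have hη' : 0 < η / (2 * (I + 1)) := by positivity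
  obtain ⟨r, hr, hNr⟩ := Metric.eventually_nhds_iff_ball.1 (hN.eventually (gt_mem_nhds hη'))
  have hlim : Tendsto (fun n : ℕ => ∫ z, (Metric.ball (0 : W) n)ᶜ.indicator (fun z => ‖θ z‖) z ∂μ)
      atTop (𝓝 (∫ z, 0 ∂μ)) := by
    refine tendsto_integral_of_dominated_convergence (fun z => ‖θ z‖)
      (fun n => hθ.norm.aestronglyMeasurable.indicator Metric.isOpen_ball.measurableSet.compl)
      hθ.norm (fun n => Eventually.of_forall fun z => ?_) (Eventually.of_forall fun z => ?_)
    · refine (norm_indicator_le_norm_self _ _).trans ?_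
      rw [norm_norm]
    · refine tendsto_const_nhds.congr' ?_
      obtain ⟨n, hn⟩ := exists_nat_gt ‖z‖
      filter_upwards [eventually_ge_atTop n] with m hm
      rw [Set.indicator_of_notMem]
      rw [Set.mem_compl_iff, not_not, mem_ball_zero_iff]
      exact hn.trans_le (by exact_mod_cast hm)
  rw [integral_zero] at hlim
  have hη2 : 0 < η / (2 * (|C| + 1)) := by positivity
  obtain ⟨n, hn, hn1⟩ := ((hlim.eventually (gt_mem_nhds hη2)).and (eventually_ge_atTop 1)).exists
  have hn0 : (0 : ℝ) < n := by exact_mod_cast hn1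
  -- This dilation sends the ball of radius n, which carries all but a small part of θ, into the
  -- ball of radius r where N is small; outside, N ≤ |C| is enough.
  refine ⟨r / n, by positivity, fun f c hc hf => ?_⟩
  have hint : Integrable ((Metric.ball (0 : W) n)ᶜ.indicator fun z => ‖θ z‖) μ :=
    hθ.norm.indicator Metric.isOpen_ball.measurableSet.compl
  calc ‖∫ z, θ z * f z ∂μ‖
      ≤ ∫ z, (η / (2 * (I + 1)) * ‖θ z‖ +
          |C| * (Metric.ball (0 : W) n)ᶜ.indicator (fun z => ‖θ z‖) z) * c ∂μ := by
        refine norm_integral_le_of_norm_le (((hθ.norm.const_mul _).add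
          (hint.const_mul _)).mul_const c) (Eventually.of_forall fun z => ?_)
        rw [norm_mul]
        refine (mul_le_mul_of_nonneg_left (hf z) (norm_nonneg _)).trans ?_
        rw [← mul_assoc]
        refine mul_le_mul_of_nonneg_right ?_ hc
        by_cases hz : z ∈ Metric.ball (0 : W) n
        · rw [Set.indicator_of_notMem (by simpa using hz), mul_zero, add_zero, mul_comm]
          refine mul_le_mul_of_nonneg_right (hNr _ ?_).le (norm_nonneg _)
          rw [mem_ball_zero_iff] at hz ⊢
          rw [norm_smul, Real.norm_of_nonneg (by positivity), div_mul_eq_mul_div,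
            div_lt_iff₀ hn0]
          gcongr
        · rw [Set.indicator_of_mem (by simpa using hz), mul_comm]
          have h1 : N ((r / n) • z) * ‖θ z‖ ≤ |C| * ‖θ z‖ := by
            gcongr
            exact (hC _).trans (le_abs_self C)
          exact h1.trans (le_add_of_nonneg_left (by positivity))
    _ = (η / (2 * (I + 1)) * I +
          |C| * ∫ z, (Metric.ball (0 : W) n)ᶜ.indicator (fun z => ‖θ z‖) z ∂μ) * c := by
        rw [integral_mul_const, integral_add (hθ.norm.const_mul _) (hint.const_mul _),
          integral_const_mul, integral_const_mul]
    _ ≤ (η / 2 + η / 2) * c := by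
        gcongr
        · calc η / (2 * (I + 1)) * I ≤ η / (2 * (I + 1)) * (I + 1) := by gcongr; linarith
            _ = η / 2 := by field_simp
        · calc _ ≤ |C| * (η / (2 * (|C| + 1))) := by gcongr
            _ ≤ (|C| + 1) * (η / (2 * (|C| + 1))) := by gcongr; linarith
            _ = η / 2 := by field_simp
    _ = η * c := by rw [add_halves]

end FourierCutoff

variable {E : Type*} [NormedAddCommGroup E] [InnerProductSpace ℝ E]
  [MeasurableSpace E] [BorelSpace E]

/-! ### Fubini for convolution kernels. -/

section Kernel

variable {X Y G : Submodule ℝ E} [FiniteDimensional ℝ X] [FiniteDimensional ℝ Y]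
  [FiniteDimensional ℝ G]

/-- The function `v ↦ |φ(v)|`. -/
def absC (φ : C_c(G, ℂ)) : C_c(G, ℂ) :=
  ⟨⟨fun v => (‖φ v‖ : ℂ), Complex.continuous_ofReal.comp φ.continuous.norm⟩,
    φ.hasCompactSupport.comp_left (g := fun z : ℂ => ((‖z‖ : ℝ) : ℂ)) (by simp)⟩

/-- The function `x ↦ |u(x)|` as an element of `L²(X)`. -/
def absL (u : HilbertL2 X) : HilbertL2 X :=
  (show MemLp (fun x => ((‖u x‖ : ℝ) : ℂ)) 2 volume from (Lp.memLp u).norm.ofReal).toLp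

theorem coeFn_absL (u : HilbertL2 X) : absL u =ᵐ[volume] fun x => ((‖u x‖ : ℝ) : ℂ) :=
  MemLp.coeFn_toLp _

theorem integrable_conv_kernel (hX : X ≤ G) (hY : Y ≤ G) (φ : C_c(G, ℂ)) (u : HilbertL2 Y)
    (v : HilbertL2 X) : Integrable (fun p : Y × X => (starRingEnd ℂ) (u p.1) *
      ((starRingEnd ℂ) (φ (Submodule.inclusion hX p.2 - Submodule.inclusion hY p.1)) * v p.2))
      (volume.prod volume) := by
  have h1 := (isometry_inclusion hX).continuous
  have h2 := (isometry_inclusion hY).continuous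
  have hφ : Continuous fun p : Y × X =>
      φ (Submodule.inclusion hX p.2 - Submodule.inclusion hY p.1) :=
    φ.continuous.comp ((h1.comp continuous_snd).sub (h2.comp continuous_fst))
  have hae : ∀ y : Y, (fun x => ⟪convSection hX hY φ y x, v x⟫_ℂ) =ᵐ[volume] fun x =>
      (starRingEnd ℂ) (φ (Submodule.inclusion hX x - Submodule.inclusion hY y)) * v x := by
    intro y
    filter_upwards [coeFn_convSection hX hY φ y] with x hx
    rw [hx, RCLike.inner_apply, mul_comm]
  rw [integrable_prod_iff]
  · refine ⟨Eventually.of_forall fun y => ?_, ?_⟩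
    · have h3 := (L2.integrable_inner (𝕜 := ℂ) (convSection hX hY φ y) v).congr (hae y)
      exact h3.const_mul ((starRingEnd ℂ) (u y))
    -- Absolute integrability comes from the bounded operator with kernel |φ|, tested on |u| and
    -- |v|.
    · obtain ⟨T, hT⟩ := exists_hasSections_convSection hX hY (absC φ)
      refine (hT.integrable_inner (absL u) (absL v)).norm.congr ?_
      filter_upwards [coeFn_absL u] with y hy
      simp only [norm_mul, RCLike.norm_conj]
      rw [hy, RCLike.inner_apply, norm_mul, RCLike.norm_conj, Complex.norm_real, norm_norm,
        integral_const_mul, mul_comm]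
      congr 1
      rw [L2.inner_def]
      have : ∫ x, ⟪convSection hX hY (absC φ) y x, absL v x⟫_ℂ = ∫ x : X,
          ((‖φ (Submodule.inclusion hX x - Submodule.inclusion hY y)‖ * ‖v x‖ : ℝ) : ℂ) := by
        refine integral_congr_ae ?_
        filter_upwards [coeFn_convSection hX hY (absC φ) y, coeFn_absL v] with x h3 h4
        rw [h3, h4, RCLike.inner_apply, mul_comm, Complex.ofReal_mul]
        exact congrArg (· * _) (Complex.conj_ofReal _)
      rw [this, integral_complex_ofReal]
      exact (Complex.norm_real _).trans (Real.norm_of_nonneg (integral_nonneg fun x => by positivity))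
  · exact (Complex.continuous_conj.comp_aestronglyMeasurable
      (Lp.aestronglyMeasurable u).comp_fst).mul
      ((Complex.continuous_conj.comp hφ).aestronglyMeasurable.mul
      (Lp.aestronglyMeasurable v).comp_snd)

/-- The definition of T_{XY}(φ) describes its rows; Fubini passes to the columns, the form used in
all approximations. -/
theorem IsConv.hasSections {hX : X ≤ G} {hY : Y ≤ G} {φ : C_c(G, ℂ)}
    {T : HilbertL2 Y →L[ℂ] HilbertL2 X} (h : IsConv hX hY φ T) :
    HasSections T (convSection hX hY φ) := by
  obtain ⟨S, hS⟩ := exists_hasSections_convSection hX hY φ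
  suffices T = S by rwa [this]
  ext1 u
  refine ext_inner_right ℂ fun v => ?_
  rw [hS.inner_apply, L2.inner_def]
  have h1 : ∀ y, ⟪u y, ⟪convSection hX hY φ y, v⟫_ℂ⟫_ℂ = ∫ x : X, (starRingEnd ℂ) (u y) *
      ((starRingEnd ℂ) (φ (Submodule.inclusion hX x - Submodule.inclusion hY y)) * v x) := by
    intro y
    rw [integral_const_mul, RCLike.inner_apply, mul_comm, L2.inner_def]
    congr 1
    refine integral_congr_ae ?_
    filter_upwards [coeFn_convSection hX hY φ y] with x hx
    rw [hx, RCLike.inner_apply, mul_comm]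
  simp_rw [h1]
  rw [integral_integral_swap (integrable_conv_kernel hX hY φ u v)]
  refine integral_congr_ae ?_
  filter_upwards [h u] with x hx
  rw [hx, RCLike.inner_apply, ← integral_conj, ← integral_const_mul]
  refine integral_congr_ae (Eventually.of_forall fun y => ?_)
  simp only [map_mul]
  ring

end Kernel

end

section

variable {E : Type*} [NormedAddCommGroup E] [InnerProductSpace ℝ E]
  [MeasurableSpace E] [BorelSpace E]

/-! ### Functions on Y/Z as functions on Y ⊖ Z. -/

section Quotient

variable {Y Z : Submodule ℝ E} [FiniteDimensional ℝ Y] [FiniteDimensional ℝ Z]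

/-- The orthogonal projection of `Y` onto `Y ⊖ Z = Y ∩ Zᗮ`, for `Z ⊆ Y`. -/
def perp (hZY : Z ≤ Y) : Y →ₗ[ℝ] ↥(Y ⊓ Zᗮ) :=
  LinearMap.codRestrict (Y ⊓ Zᗮ) (Y.subtype - Z.starProjection.toLinearMap ∘ₗ Y.subtype)
    fun y => ⟨Y.sub_mem y.2 (hZY (Z.starProjection_apply_mem _)),
      Z.sub_starProjection_mem_orthogonal _⟩

theorem coe_perp (hZY : Z ≤ Y) (y : Y) :
    (perp hZY y : E) = y - Z.starProjection (y : E) := rfl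

theorem continuous_perp (hZY : Z ≤ Y) : Continuous (perp hZY) :=
  (perp hZY).continuous_of_finiteDimensional

theorem perp_add_coe (hZY : Z ≤ Y) (y : Y) (z : Z) :
    perp hZY (y + Submodule.inclusion hZY z) = perp hZY y := by
  refine Subtype.ext ?_
  rw [coe_perp, coe_perp, Submodule.coe_add, map_add, Submodule.coe_inclusion,
    Submodule.starProjection_eq_self_iff.2 z.2]
  abel

theorem inner_perp (hZY : Z ≤ Y) (y : Y) {k : E} (hk : k ∈ Zᗮ) :
    ⟪(perp hZY y : E), k⟫_ℝ = ⟪(y : E), k⟫_ℝ := by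
  rw [coe_perp, inner_sub_left, Submodule.inner_right_of_mem_orthogonal
    (Z.starProjection_apply_mem (y : E)) hk, sub_zero]

/-- The map `Y/Z → Y ⊖ Z` induced by `perp`. -/
def quotPerp (hZY : Z ≤ Y) : Y ⧸ Z.submoduleOf Y →ₗ[ℝ] ↥(Y ⊓ Zᗮ) :=
  (Z.submoduleOf Y).liftQ (perp hZY) fun y hy => by
    rw [LinearMap.mem_ker]
    refine Subtype.ext ?_
    rw [coe_perp, Submodule.starProjection_eq_self_iff.2 (show (y : E) ∈ Z from hy), sub_self]
    rfl

theorem continuous_quotPerp (hZY : Z ≤ Y) : Continuous (quotPerp hZY) :=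
  continuous_quot_lift _ (continuous_perp hZY)

theorem mkQ_perp (hZY : Z ≤ Y) (y : Y) :
    (Z.submoduleOf Y).mkQ (Submodule.inclusion inf_le_left (perp hZY y)) =
      (Z.submoduleOf Y).mkQ y := by
  rw [Submodule.mkQ_apply, Submodule.mkQ_apply, Submodule.Quotient.eq]
  change ((Submodule.inclusion inf_le_left (perp hZY y) : Y) : E) - y ∈ Z
  rw [Submodule.coe_inclusion, coe_perp, sub_sub_cancel_left]
  exact Z.neg_mem (Z.starProjection_apply_mem _)

/-- Compactly supported functions on `Y ⊖ Z` come from functions on `Y/Z`. -/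
theorem exists_liftQuot_eq (hZY : Z ≤ Y) (g : C_c(↥(Y ⊓ Zᗮ), ℂ)) :
    ∃ ψ : C₀(Y ⧸ Z.submoduleOf Y, ℂ), ∀ y, liftQuot Y Z ψ y = g (perp hZY y) := by
  refine ⟨⟨⟨fun q => g (quotPerp hZY q), g.continuous.comp (continuous_quotPerp hZY)⟩, ?_⟩,
    fun y => rfl⟩
  -- Every class is represented by its component orthogonal to Z, so this compact image contains
  -- every point where the function on Y/Z is nonzero.
  have hK : IsCompact ((fun w : ↥(Y ⊓ Zᗮ) => (Z.submoduleOf Y).mkQ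
      (Submodule.inclusion inf_le_left w)) '' tsupport g) := by
    refine g.hasCompactSupport.isCompact.image ?_
    exact Continuous.comp continuous_quot_mk
      (isometry_inclusion (inf_le_left : Y ⊓ Zᗮ ≤ Y)).continuous
  refine tendsto_const_nhds.congr' ?_
  filter_upwards [hK.compl_mem_cocompact] with q hq
  by_contra hne
  refine hq ⟨quotPerp hZY q, subset_tsupport _ (Ne.symm hne), ?_⟩
  obtain ⟨y, rfl⟩ := (Z.submoduleOf Y).mkQ_surjective q
  exact mkQ_perp hZY y

theorem liftQuot_add_coe (hZY : Z ≤ Y) (ψ : C₀(Y ⧸ Z.submoduleOf Y, ℂ)) (y : Y) (z : Z) :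
    liftQuot Y Z ψ (y + Submodule.inclusion hZY z) = liftQuot Y Z ψ y := by
  change ψ ((Z.submoduleOf Y).mkQ _) = ψ ((Z.submoduleOf Y).mkQ _)
  rw [← mkQ_perp hZY, perp_add_coe, mkQ_perp]

theorem uniformContinuous_liftQuot (ψ : C₀(Y ⧸ Z.submoduleOf Y, ℂ)) :
    UniformContinuous (liftQuot Y Z ψ) := by
  have h1 : UniformContinuous ψ := ZeroAtInftyContinuousMap.uniformContinuous ψ
  have h2 : UniformContinuous (Z.submoduleOf Y).mkQ := by
    refine LipschitzWith.uniformContinuous (K := 1) (LipschitzWith.of_dist_le_mul fun a b => ?_)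
    rw [dist_eq_norm, dist_eq_norm, ← map_sub, NNReal.coe_one, one_mul]
    exact Submodule.Quotient.norm_mk_le _ _
  exact h1.comp h2

/-- For k orthogonal to Z the phase at y depends only on y^⊥. It is uniformly near 1 where y^⊥ is
bounded, and elsewhere ψ is small. Membership of k in Y is not needed, which allows k in X ⊖ Z
later. -/
theorem tendsto_norm_planeWave_mul_liftQuot {ι : Type*} {l : Filter ι} {k : ι → E}
    (hZY : Z ≤ Y) (hk : Tendsto k l (𝓝 0)) (hkZ : ∀ i, k i ∈ Zᗮ)
    (ψ : C₀(Y ⧸ Z.submoduleOf Y, ℂ)) :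
    Tendsto (fun i => ‖planeWave Y (k i) * liftQuot Y Z ψ - liftQuot Y Z ψ‖) l (𝓝 0) := by
  refine tendsto_order.2 ⟨fun a ha => Eventually.of_forall fun i => ha.trans_le (norm_nonneg _),
    fun ε hε => ?_⟩
  obtain ⟨t, ht, htψ⟩ := mem_cocompact.1
    (ψ.zero_at_infty' (Metric.ball_mem_nhds (0 : ℂ) (show 0 < ε / 4 by positivity)))
  obtain ⟨R, hR⟩ := (ht.image (continuous_quotPerp hZY)).isBounded.exists_norm_le
  set M := ‖liftQuot Y Z ψ‖
  have hM : 0 ≤ M := norm_nonneg _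
  have hδ : 0 < ε / (2 * (|R| * M + 1)) := by positivity
  filter_upwards [hk (Metric.ball_mem_nhds 0 hδ)] with i hi
  have hi' : ‖k i‖ < ε / (2 * (|R| * M + 1)) := by simpa using hi
  refine lt_of_le_of_lt ((BoundedContinuousFunction.norm_le (half_pos hε).le).2 fun y => ?_)
    (half_lt_self hε)
  rw [BoundedContinuousFunction.sub_apply, BoundedContinuousFunction.mul_apply, ← sub_one_mul,
    norm_mul]
  by_cases hy : (Z.submoduleOf Y).mkQ y ∈ t
  · have h1 : ‖perp hZY y‖ ≤ |R| := (hR _ ⟨_, hy, rfl⟩).trans (le_abs_self R)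
    have h2 : ‖planeWave Y (k i) y - 1‖ ≤ |R| * ‖k i‖ := by
      rw [planeWave_apply, ← inner_perp hZY y (hkZ i)]
      refine (Real.norm_exp_I_mul_ofReal_sub_one_le).trans ?_
      refine (norm_inner_le_norm (𝕜 := ℝ) (perp hZY y : E) (k i)).trans ?_
      gcongr
      exact h1
    calc _ ≤ (|R| * (ε / (2 * (|R| * M + 1)))) * M := by
          gcongr
          · exact h2.trans (by gcongr)
          · exact (liftQuot Y Z ψ).norm_coe_le_norm y
      _ = ε / 2 * (|R| * M / (|R| * M + 1)) := by field_simp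
      _ ≤ ε / 2 * 1 := by
        gcongr
        rw [div_le_one (by positivity)]
        linarith
      _ = ε / 2 := mul_one _
  · have h1 : ‖liftQuot Y Z ψ y‖ < ε / 4 := mem_ball_zero_iff.1 (htψ hy)
    have h2 : ‖planeWave Y (k i) y - 1‖ ≤ 2 := by
      refine (norm_sub_le _ _).trans ?_
      rw [planeWave_apply, mul_comm, Complex.norm_exp_ofReal_mul_I, norm_one]
      norm_num
    calc _ ≤ 2 * (ε / 4) := by gcongr
      _ = ε / 2 := by ring

end Quotient

/-! ### Commuting multiplications past translations and phases. -/

section Translation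

variable {Y : Submodule ℝ E} [FiniteDimensional ℝ Y]

/-- The translate `y ↦ f(y - a)` of a bounded continuous function. -/
def translBCF (f : Y →ᵇ ℂ) (a : Y) : Y →ᵇ ℂ :=
  f.compContinuous ⟨fun y => y - a, continuous_sub_right a⟩

theorem translBCF_apply (f : Y →ᵇ ℂ) (a y : Y) : translBCF f a y = f (y - a) := rfl

theorem mulOp_comp_translOp (f : Y →ᵇ ℂ) (a : Y) :
    mulOp Y f ∘L translOp Y a = translOp Y a ∘L mulOp Y (translBCF f a) := by
  ext1 u
  refine Lp.ext ?_
  rw [ContinuousLinearMap.comp_apply, ContinuousLinearMap.comp_apply]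
  filter_upwards [coeFn_mulOp Y f (translOp Y a u), coeFn_translOp Y a u,
    coeFn_translOp Y a (mulOp Y (translBCF f a) u),
    (measurePreserving_add_right volume a).quasiMeasurePreserving.ae
      (coeFn_mulOp Y (translBCF f a) u)] with y h1 h2 h3 h4
  rw [h1, h2, h3, h4, translBCF_apply, add_sub_cancel_right]

theorem mulOp_comp_phaseOp (f : Y →ᵇ ℂ) (k : E) :
    mulOp Y f ∘L phaseOp Y k = phaseOp Y k ∘L mulOp Y f := by
  rw [phaseOp, ← mulOp_mul, ← mulOp_mul, mul_comm]

theorem tendsto_norm_translBCF {f : Y →ᵇ ℂ} (hf : UniformContinuous f) :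
    Tendsto (fun a => ‖translBCF f a - f‖) (𝓝 0) (𝓝 0) := by
  refine tendsto_order.2 ⟨fun a ha => Eventually.of_forall fun i => ha.trans_le (norm_nonneg _),
    fun ε hε => ?_⟩
  obtain ⟨δ, hδ, h⟩ := Metric.uniformContinuous_iff.1 hf (ε / 2) (half_pos hε)
  filter_upwards [Metric.ball_mem_nhds 0 hδ] with a ha
  refine lt_of_le_of_lt ((BoundedContinuousFunction.norm_le (half_pos hε).le).2 fun y => ?_)
    (half_lt_self hε)
  rw [BoundedContinuousFunction.sub_apply, translBCF_apply, ← dist_eq_norm]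
  refine (h ?_).le
  rw [dist_eq_norm, sub_sub_cancel_left, norm_neg]
  simpa using ha

end Translation

/-! ### Necessity of the three conditions. -/

section Necessity

variable {X Y Z G : Submodule ℝ E} [FiniteDimensional ℝ X] [FiniteDimensional ℝ Y]
  [FiniteDimensional ℝ Z] [FiniteDimensional ℝ G] {hX : X ≤ G} {hY : Y ≤ G}

/-- The operators that are asymptotically fixed by a family of maps `T ↦ L T R` form a closed
subspace. -/
def almostFixed {ι : Type*} (l : Filter ι) (L : ι → HilbertL2 X →L[ℂ] HilbertL2 X)
    (R : ι → HilbertL2 Y →L[ℂ] HilbertL2 Y) : Submodule ℂ (HilbertL2 Y →L[ℂ] HilbertL2 X) where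
  carrier := {T | Tendsto (fun i => ‖L i ∘L T ∘L R i - T‖) l (𝓝 0)}
  zero_mem' := by
    simp only [Set.mem_ofPred_eq, ContinuousLinearMap.zero_comp, ContinuousLinearMap.comp_zero,
      sub_zero, norm_zero]
    exact tendsto_const_nhds
  add_mem' {T S} hT hS := by
    refine squeeze_zero (fun i => norm_nonneg _) (fun i => ?_)
      (by simpa only [add_zero] using hT.add hS)
    rw [ContinuousLinearMap.add_comp, ContinuousLinearMap.comp_add, add_sub_add_comm]
    exact norm_add_le _ _
  smul_mem' c T hT := by
    refine squeeze_zero (fun i => norm_nonneg _) (fun i => ?_)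
      (by simpa only [mul_zero] using hT.const_mul ‖c‖)
    rw [ContinuousLinearMap.smul_comp, ContinuousLinearMap.comp_smul, ← smul_sub, norm_smul]

theorem mem_almostFixed {ι : Type*} {l : Filter ι} {L : ι → HilbertL2 X →L[ℂ] HilbertL2 X}
    {R : ι → HilbertL2 Y →L[ℂ] HilbertL2 Y} {T : HilbertL2 Y →L[ℂ] HilbertL2 X} :
    T ∈ almostFixed l L R ↔ Tendsto (fun i => ‖L i ∘L T ∘L R i - T‖) l (𝓝 0) := Iff.rfl

theorem norm_comp_comp_le {A : HilbertL2 X →L[ℂ] HilbertL2 X} {B : HilbertL2 Y →L[ℂ] HilbertL2 Y}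
    (hA : ‖A‖ ≤ 1) (hB : ‖B‖ ≤ 1) (T : HilbertL2 Y →L[ℂ] HilbertL2 X) : ‖A ∘L T ∘L B‖ ≤ ‖T‖ :=
  calc ‖A ∘L T ∘L B‖ ≤ ‖A‖ * (‖T‖ * ‖B‖) :=
        (ContinuousLinearMap.opNorm_comp_le _ _).trans (by
          gcongr
          exact ContinuousLinearMap.opNorm_comp_le _ _)
    _ ≤ 1 * (‖T‖ * 1) := by gcongr
    _ = ‖T‖ := by ring

theorem isClosed_almostFixed {ι : Type*} {l : Filter ι} {L : ι → HilbertL2 X →L[ℂ] HilbertL2 X}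
    {R : ι → HilbertL2 Y →L[ℂ] HilbertL2 Y} (hL : ∀ i, ‖L i‖ ≤ 1) (hR : ∀ i, ‖R i‖ ≤ 1) :
    IsClosed (almostFixed l L R : Set (HilbertL2 Y →L[ℂ] HilbertL2 X)) := by
  refine isClosed_of_closure_subset fun T hT => ?_
  rw [SetLike.mem_coe, mem_almostFixed]
  refine tendsto_order.2 ⟨fun a ha => Eventually.of_forall fun i => ha.trans_le (norm_nonneg _),
    fun ε hε => ?_⟩
  obtain ⟨S, hS, hST⟩ := Metric.mem_closure_iff.1 hT (ε / 3) (by positivity)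
  rw [dist_eq_norm] at hST
  filter_upwards [(mem_almostFixed.1 hS).eventually (gt_mem_nhds (show 0 < ε / 3 by positivity))]
    with i hi
  have h1 : L i ∘L T ∘L R i - T = L i ∘L (T - S) ∘L R i + (L i ∘L S ∘L R i - S) - (T - S) := by
    rw [ContinuousLinearMap.sub_comp, ContinuousLinearMap.comp_sub]
    abel
  rw [h1]
  have h2 := norm_sub_le (L i ∘L (T - S) ∘L R i + (L i ∘L S ∘L R i - S)) (T - S)
  have h3 := norm_add_le (L i ∘L (T - S) ∘L R i) (L i ∘L S ∘L R i - S)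
  have h4 := norm_comp_comp_le (hL i) (hR i) (T - S)
  linarith

/-- Composition with a fixed multiplier is continuous, so both closures, in 𝒯_{XY} and in the span,
are absorbed by a closed subspace. -/
theorem couplingSpace_le {P : Submodule ℂ (HilbertL2 Y →L[ℂ] HilbertL2 X)}
    (hP : IsClosed (P : Set (HilbertL2 Y →L[ℂ] HilbertL2 X)))
    (h : ∀ (φ : C_c(G, ℂ)) (A : HilbertL2 Y →L[ℂ] HilbertL2 X)
      (ψ : C₀(Y ⧸ Z.submoduleOf Y, ℂ)), IsConv hX hY φ A →
      A ∘L mulOp Y (liftQuot Y Z ψ) ∈ P) :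
    couplingSpace X Y G Z hX hY ≤ P := by
  refine Submodule.topologicalClosure_minimal _ (Submodule.span_le.2 ?_) hP
  rintro _ ⟨A, hA, _, ⟨ψ, rfl⟩, rfl⟩
  have hc : Continuous fun A : HilbertL2 Y →L[ℂ] HilbertL2 X => A ∘L mulOp Y (liftQuot Y Z ψ) :=
    continuous_id.clm_comp continuous_const
  have : closure (convOps X Y G hX hY) ⊆
      (fun A : HilbertL2 Y →L[ℂ] HilbertL2 X => A ∘L mulOp Y (liftQuot Y Z ψ)) ⁻¹' P := by
    refine closure_minimal ?_ (hP.preimage hc)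
    rintro A ⟨φ, hφ⟩
    exact h φ A ψ hφ
  exact this hA

theorem mem_couplingSpace {φ : C_c(G, ℂ)} {A : HilbertL2 Y →L[ℂ] HilbertL2 X}
    (hA : IsConv hX hY φ A) (ψ : C₀(Y ⧸ Z.submoduleOf Y, ℂ)) :
    A ∘L mulOp Y (liftQuot Y Z ψ) ∈ couplingSpace X Y G Z hX hY :=
  Submodule.le_topologicalClosure _ (Submodule.subset_span
    ⟨A, subset_closure ⟨φ, hA⟩, _, ⟨ψ, rfl⟩, rfl⟩)

theorem IsConv.unique {φ : G → ℂ} {A B : HilbertL2 Y →L[ℂ] HilbertL2 X}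
    (hA : IsConv hX hY φ A) (hB : IsConv hX hY φ B) : A = B := by
  ext1 u
  exact Lp.ext ((hA u).trans (hB u).symm)

theorem tendsto_norm_comp_right {ι : Type*} {l : Filter ι}
    {T : ι → HilbertL2 Y →L[ℂ] HilbertL2 X} (hT : Tendsto (fun i => ‖T i‖) l (𝓝 0))
    {B : ι → HilbertL2 Y →L[ℂ] HilbertL2 Y} {M : ℝ} (hB : ∀ i, ‖B i‖ ≤ M) :
    Tendsto (fun i => ‖T i ∘L B i‖) l (𝓝 0) := by
  refine squeeze_zero (fun i => norm_nonneg _) (fun i => ?_)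
    (by simpa only [zero_mul] using hT.mul_const M)
  exact (ContinuousLinearMap.opNorm_comp_le _ _).trans (by gcongr; exact hB i)

theorem tendsto_norm_comp_left {ι : Type*} {l : Filter ι} (A : HilbertL2 Y →L[ℂ] HilbertL2 X)
    {B : ι → HilbertL2 Y →L[ℂ] HilbertL2 Y} (hB : Tendsto (fun i => ‖B i‖) l (𝓝 0)) :
    Tendsto (fun i => ‖A ∘L B i‖) l (𝓝 0) := by
  refine squeeze_zero (fun i => norm_nonneg _) (fun i => ?_)
    (by simpa only [mul_zero] using hB.const_mul ‖A‖)
  exact ContinuousLinearMap.opNorm_comp_le _ _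

theorem tendsto_norm_add {ι : Type*} {l : Filter ι} {T S : ι → HilbertL2 Y →L[ℂ] HilbertL2 X}
    (hT : Tendsto (fun i => ‖T i‖) l (𝓝 0)) (hS : Tendsto (fun i => ‖S i‖) l (𝓝 0)) :
    Tendsto (fun i => ‖T i + S i‖) l (𝓝 0) :=
  squeeze_zero (fun i => norm_nonneg _) (fun i => norm_add_le _ _)
    (by simpa only [add_zero] using hT.add hS)

variable {T : HilbertL2 Y →L[ℂ] HilbertL2 X}

/-- Both sides are convolution with φ shifted by z, which is the same vector of G whether z is taken
in X or in Y. -/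
theorem IsConv.translOp_comm (hZX : Z ≤ X) (hZY : Z ≤ Y) {φ : C_c(G, ℂ)} (hT : IsConv hX hY φ T)
    (z : Z) : T ∘L translOp Y (Submodule.inclusion hZY z) =
      translOp X (Submodule.inclusion hZX z) ∘L T :=
  (hT.comp_translOp _).unique (hT.translOp_comp (Submodule.inclusion hZX z))

theorem mulOp_liftQuot_translOp_comm (hZY : Z ≤ Y) (ψ : C₀(Y ⧸ Z.submoduleOf Y, ℂ)) (z : Z) :
    mulOp Y (liftQuot Y Z ψ) ∘L translOp Y (Submodule.inclusion hZY z) =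
      translOp Y (Submodule.inclusion hZY z) ∘L mulOp Y (liftQuot Y Z ψ) := by
  rw [mulOp_comp_translOp]
  congr 2
  ext y
  rw [translBCF_apply, ← liftQuot_add_coe hZY ψ _ z, sub_add_cancel]

theorem translOp_conj_of_mem_couplingSpace (hZX : Z ≤ X) (hZY : Z ≤ Y)
    (hT : T ∈ couplingSpace X Y G Z hX hY) (z : Z) :
    (translOp X (Submodule.inclusion hZX z)).adjoint ∘L T ∘L
      translOp Y (Submodule.inclusion hZY z) = T := by
  -- Along `pure ()` convergence to 0 means being 0, so exact invariance is a case of asymptotic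
  -- invariance.
  have h : couplingSpace X Y G Z hX hY ≤ almostFixed (pure ())
      (fun _ => (translOp X (Submodule.inclusion hZX z)).adjoint)
      (fun _ => translOp Y (Submodule.inclusion hZY z)) := by
    refine couplingSpace_le (isClosed_almostFixed (fun _ => ?_) fun _ => norm_translOp_le _ _) ?_
    · rw [adjoint_translOp]
      exact norm_translOp_le _ _
    · intro φ A ψ hA
      rw [mem_almostFixed, adjoint_translOp, ContinuousLinearMap.comp_assoc,
        mulOp_liftQuot_translOp_comm, ← ContinuousLinearMap.comp_assoc A, hA.translOp_comm hZX hZY,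
        ContinuousLinearMap.comp_assoc (translOp X _), ← ContinuousLinearMap.comp_assoc,
        translOp_neg_comp]
      change Tendsto (fun _ => ‖A ∘L mulOp Y (liftQuot Y Z ψ) - A ∘L mulOp Y (liftQuot Y Z ψ)‖) _ _
      rw [sub_self, norm_zero]
      exact tendsto_const_nhds
  have := tendsto_nhds_unique (mem_almostFixed.1 (h hT)) (tendsto_pure_nhds _ _)
  exact sub_eq_zero.1 (norm_eq_zero.1 this.symm)

theorem tendsto_phaseOp_conj_of_isConv {φ : C_c(G, ℂ)} (hT : IsConv hX hY φ T) :
    Tendsto (fun z : Z => ‖(phaseOp X (z : E)).adjoint ∘L T ∘L phaseOp Y (z : E) - T‖)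
      (𝓝 0) (𝓝 0) := by
  have hk : Tendsto (fun z : Z => -(z : E)) (𝓝 0) (𝓝 0) := by
    have : Continuous fun z : Z => -(z : E) := continuous_subtype_val.neg
    simpa using this.tendsto 0
  simpa only [adjoint_phaseOp, neg_neg] using hT.tendsto_phaseOp hk

theorem tendsto_phaseOp_conj_of_mem_couplingSpace (hT : T ∈ couplingSpace X Y G Z hX hY) :
    Tendsto (fun z : Z => ‖(phaseOp X (z : E)).adjoint ∘L T ∘L phaseOp Y (z : E) - T‖)
      (𝓝 0) (𝓝 0) := by
  refine mem_almostFixed.1 (couplingSpace_le (isClosed_almostFixed (fun z => ?_)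
    fun z => norm_phaseOp_le _ _) ?_ hT)
  · rw [adjoint_phaseOp]
    exact norm_phaseOp_le _ _
  · intro φ A ψ hA
    rw [mem_almostFixed]
    refine (tendsto_norm_comp_right (tendsto_phaseOp_conj_of_isConv (Z := Z) hA)
      (fun _ => le_refl ‖mulOp Y (liftQuot Y Z ψ)‖)).congr fun z => ?_
    rw [ContinuousLinearMap.sub_comp, ContinuousLinearMap.comp_assoc A, mulOp_comp_phaseOp]
    rfl

theorem tendsto_comp_translOp_of_mem_couplingSpace (hT : T ∈ couplingSpace X Y G Z hX hY) :
    Tendsto (fun y : Y => ‖T ∘L (translOp Y y - 1)‖) (𝓝 0) (𝓝 0) := by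
  have h : T ∈ almostFixed (𝓝 0) (fun _ => 1) (translOp Y) := by
    refine couplingSpace_le (isClosed_almostFixed (fun y => ContinuousLinearMap.norm_id_le)
      (norm_translOp_le Y)) ?_ hT
    intro φ A ψ hA
    rw [mem_almostFixed]
    have ha : Tendsto (fun y : Y => Submodule.inclusion hY y) (𝓝 0) (𝓝 0) := by
      simpa using (isometry_inclusion hY).continuous.tendsto 0
    -- With B_y multiplication by the translated function, ABU_y - AB = (AU_y - A)B_y + A(B_y - B);
    -- this is the first term and `h2` the second.
    have h1 := tendsto_norm_comp_right (tendsto_norm_sub_of_shift hA ha fun y => hA.comp_translOp y)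
      (B := fun y => mulOp Y (translBCF (liftQuot Y Z ψ) y)) (M := ‖liftQuot Y Z ψ‖)
      (fun y => (norm_mulOp_le _ _).trans (BoundedContinuousFunction.norm_compContinuous_le _ _))
    have h2 := tendsto_norm_comp_left A (squeeze_zero (fun y => norm_nonneg _)
      (fun y => norm_mulOp_le Y (translBCF (liftQuot Y Z ψ) y - liftQuot Y Z ψ))
      (tendsto_norm_translBCF (uniformContinuous_liftQuot ψ)))
    refine (tendsto_norm_add h1 h2).congr fun y => ?_
    rw [ContinuousLinearMap.comp_assoc A, mulOp_comp_translOp, mulOp_sub,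
      ContinuousLinearMap.comp_sub, ContinuousLinearMap.sub_comp]
    congr 1
    change _ = A ∘L translOp Y y ∘L mulOp Y (translBCF (liftQuot Y Z ψ) y) -
      A ∘L mulOp Y (liftQuot Y Z ψ)
    rw [← ContinuousLinearMap.comp_assoc]
    abel
  refine (mem_almostFixed.1 h).congr fun y => ?_
  rw [ContinuousLinearMap.comp_sub]
  rfl

theorem tendsto_comp_phaseOp_of_mem_couplingSpace (hZY : Z ≤ Y)
    (hT : T ∈ couplingSpace X Y G Z hX hY) :
    Tendsto (fun k : ↥(Y ⊓ Zᗮ) => ‖T ∘L (phaseOp Y (k : E) - 1)‖) (𝓝 0) (𝓝 0) := by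
  have h : T ∈ almostFixed (𝓝 0) (fun _ => 1) (fun k : ↥(Y ⊓ Zᗮ) => phaseOp Y (k : E)) := by
    refine couplingSpace_le (isClosed_almostFixed (fun y => ContinuousLinearMap.norm_id_le)
      (fun k => norm_phaseOp_le Y _)) ?_ hT
    intro φ A ψ hA
    rw [mem_almostFixed]
    have hk : Tendsto (fun k : ↥(Y ⊓ Zᗮ) => (k : E)) (𝓝 0) (𝓝 0) :=
      continuous_subtype_val.tendsto 0
    have h2 := tendsto_norm_comp_left A (squeeze_zero (fun y => norm_nonneg _)
      (fun y => norm_mulOp_le Y _)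
      (tendsto_norm_planeWave_mul_liftQuot hZY hk (fun k => k.2.2) ψ))
    refine h2.congr fun k => ?_
    rw [ContinuousLinearMap.comp_assoc A, mulOp_comp_phaseOp, mulOp_sub, mulOp_mul,
      ContinuousLinearMap.comp_sub]
    rfl
  refine (mem_almostFixed.1 h).congr fun y => ?_
  rw [ContinuousLinearMap.comp_sub]
  rfl

theorem tendsto_translOp_comp_of_mem_couplingSpace (hT : T ∈ couplingSpace X Y G Z hX hY) :
    Tendsto (fun x : X => ‖(translOp X x - 1) ∘L T‖) (𝓝 0) (𝓝 0) := by
  have h : T ∈ almostFixed (𝓝 0) (translOp X) (fun _ => 1) := by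
    refine couplingSpace_le (isClosed_almostFixed (norm_translOp_le X)
      (fun y => ContinuousLinearMap.norm_id_le)) ?_ hT
    intro φ A ψ hA
    rw [mem_almostFixed]
    have ha : Tendsto (fun x : X => Submodule.inclusion hX x) (𝓝 0) (𝓝 0) := by
      simpa using (isometry_inclusion hX).continuous.tendsto 0
    refine (tendsto_norm_comp_right (tendsto_norm_sub_of_shift hA ha fun x => hA.translOp_comp x)
      (fun _ => le_refl ‖mulOp Y (liftQuot Y Z ψ)‖)).congr fun x => ?_
    rw [ContinuousLinearMap.sub_comp]
    rfl
  refine (mem_almostFixed.1 h).congr fun y => ?_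
  rw [ContinuousLinearMap.sub_comp]
  rfl

theorem tendsto_phaseOp_comp_of_mem_couplingSpace (hZY : Z ≤ Y)
    (hT : T ∈ couplingSpace X Y G Z hX hY) :
    Tendsto (fun k : ↥(X ⊓ Zᗮ) => ‖(phaseOp X (k : E) - 1) ∘L T‖) (𝓝 0) (𝓝 0) := by
  have h : T ∈ almostFixed (𝓝 0) (fun k : ↥(X ⊓ Zᗮ) => phaseOp X (k : E)) (fun _ => 1) := by
    refine couplingSpace_le (isClosed_almostFixed (fun k => norm_phaseOp_le X _)
      (fun y => ContinuousLinearMap.norm_id_le)) ?_ hT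
    intro φ A ψ hA
    rw [mem_almostFixed]
    have hk : Tendsto (fun k : ↥(X ⊓ Zᗮ) => (k : E)) (𝓝 0) (𝓝 0) :=
      continuous_subtype_val.tendsto 0
    -- Splitting: V_k AB - AB = (V_k A V_{-k} - A)V_k B + A(V_k B - B).
    have h1 := tendsto_norm_comp_right (hA.tendsto_phaseOp hk)
      (B := fun k : ↥(X ⊓ Zᗮ) => phaseOp Y (k : E) ∘L mulOp Y (liftQuot Y Z ψ))
      (M := 1 * ‖mulOp Y (liftQuot Y Z ψ)‖)
      (fun k => (ContinuousLinearMap.opNorm_comp_le _ _).trans (by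
        gcongr
        exact norm_phaseOp_le Y _))
    have h2 := tendsto_norm_comp_left A (squeeze_zero (fun y => norm_nonneg _)
      (fun y => norm_mulOp_le Y _)
      (tendsto_norm_planeWave_mul_liftQuot hZY hk (fun k => k.2.2) ψ))
    refine (tendsto_norm_add h1 h2).congr fun k => ?_
    have h3 : (phaseOp X (k : E) ∘L A ∘L phaseOp Y (-(k : E))) ∘L phaseOp Y (k : E) =
        phaseOp X (k : E) ∘L A := by
      rw [ContinuousLinearMap.comp_assoc, ContinuousLinearMap.comp_assoc, phaseOp_neg_comp]
      rfl
    rw [ContinuousLinearMap.sub_comp, ← ContinuousLinearMap.comp_assoc, h3, mulOp_sub, mulOp_mul,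
      ContinuousLinearMap.comp_sub]
    congr 1
    change _ = (phaseOp X (k : E) ∘L A) ∘L mulOp Y (liftQuot Y Z ψ) - A ∘L mulOp Y (liftQuot Y Z ψ)
    have h4 : mulOp Y (planeWave Y (k : E)) = phaseOp Y (k : E) := rfl
    rw [h4]
    abel
  refine (mem_almostFixed.1 h).congr fun y => ?_
  rw [ContinuousLinearMap.sub_comp]
  rfl

end Necessity

end

section

variable {E : Type*} [NormedAddCommGroup E] [InnerProductSpace ℝ E]
  [MeasurableSpace E] [BorelSpace E]

/-! ### Regularization of T by averaging phases and translations. -/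

section Averages

theorem opNorm_le_of_inner_le {H K : Type*} [NormedAddCommGroup H] [InnerProductSpace ℂ H]
    [NormedAddCommGroup K] [InnerProductSpace ℂ K] {T : H →L[ℂ] K} {M : ℝ} (hM : 0 ≤ M)
    (h : ∀ u v, ‖⟪T u, v⟫_ℂ‖ ≤ M * (‖u‖ * ‖v‖)) : ‖T‖ ≤ M := by
  refine ContinuousLinearMap.opNorm_le_bound _ hM fun u => ?_
  rcases (norm_nonneg (T u)).eq_or_lt with h0 | h0
  · rw [← h0]; positivity
  · have h1 := h u (T u)
    rw [inner_self_eq_norm_sq_to_K, norm_pow, RCLike.norm_ofReal, abs_norm] at h1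
    nlinarith

theorem exists_dilation {W : Type*} [NormedAddCommGroup W] [NormedSpace ℝ W] (χ : C_c(W, ℂ))
    {ε : ℝ} (hε : ε ≠ 0) : ∃ g : C_c(W, ℂ), ∀ w, g w = χ (ε • w) :=
  ⟨⟨⟨fun w => χ (ε • w), χ.continuous.comp (continuous_const_smul ε)⟩,
    χ.hasCompactSupport.comp_homeomorph (Homeomorph.smulOfNeZero ε hε)⟩, fun _ => rfl⟩

theorem integrable_phase_mul {W α : Type*} [MeasurableSpace W] [MeasurableSpace α]
    {κ : Measure W} {μ : Measure α} [SFinite κ] [SFinite μ] {θ : W → ℂ} (hθ : Integrable θ κ)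
    {f : α → ℂ} (hf : Integrable f μ) {p : W × α → ℝ} (hp : Measurable p) :
    Integrable (fun q : W × α => θ q.1 * (Complex.exp (Complex.I * (p q : ℂ)) * f q.2))
      (κ.prod μ) := by
  have h : Integrable (fun q : W × α => Complex.exp (Complex.I * (p q : ℂ)) * (θ q.1 * f q.2))
      (κ.prod μ) := by
    refine (hθ.mul_prod hf).bdd_mul (c := 1) ?_ (Eventually.of_forall fun q => ?_)
    · exact (Complex.measurable_exp.comp
        ((Complex.measurable_ofReal.comp hp).const_mul _)).aestronglyMeasurable
    · rw [mul_comm, Complex.norm_exp_ofReal_mul_I]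
  refine h.congr (Eventually.of_forall fun q => ?_)
  simp only
  ring

variable {X Y Z : Submodule ℝ E} [FiniteDimensional ℝ X] [FiniteDimensional ℝ Y]
  [FiniteDimensional ℝ Z]

theorem inner_phaseOp (k : E) (w u : HilbertL2 Y) : ⟪w, phaseOp Y k u⟫_ℂ =
    ∫ y : Y, Complex.exp (Complex.I * ((⟪(y : E), k⟫_ℝ : ℝ) : ℂ)) * ⟪w y, u y⟫_ℂ := by
  rw [L2.inner_def]
  refine integral_congr_ae ?_
  filter_upwards [coeFn_phaseOp Y k u] with y hy
  rw [hy, RCLike.inner_apply, RCLike.inner_apply, mul_assoc]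

theorem norm_comp_sub_one_le {H K : Type*} [NormedAddCommGroup H] [NormedSpace ℂ H]
    [NormedAddCommGroup K] [NormedSpace ℂ K] (T : H →L[ℂ] K) {V : H →L[ℂ] H} (hV : ‖V‖ ≤ 1) :
    ‖T ∘L (V - 1)‖ ≤ ‖T‖ * 2 := by
  refine (ContinuousLinearMap.opNorm_comp_le _ _).trans ?_
  gcongr
  refine (norm_sub_le _ _).trans ?_
  have : ‖(1 : H →L[ℂ] H)‖ ≤ 1 := ContinuousLinearMap.norm_id_le
  linarith

/-- Multiplication by g(y^⊥) is weakly ∫ θ(k) V_{εk} dk with ∫ θ = 1, so the error is the average of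
T(V_{εk} - 1), small once ε is small. -/
theorem exists_cutoff_norm_comp_sub_le (hZY : Z ≤ Y) {T : HilbertL2 Y →L[ℂ] HilbertL2 X}
    (hT : Tendsto (fun k : ↥(Y ⊓ Zᗮ) => ‖T ∘L (phaseOp Y (k : E) - 1)‖) (𝓝 0) (𝓝 0))
    {η : ℝ} (hη : 0 < η) :
    ∃ g : C_c(↥(Y ⊓ Zᗮ), ℂ), ∀ f : Y →ᵇ ℂ, (∀ y, f y = g (perp hZY y)) →
      ‖T ∘L mulOp Y f - T‖ ≤ η := by
  obtain ⟨θ, hθ, χ, hχ0, hχ⟩ := exists_integrable_fourier_compactSupport ↥(Y ⊓ Zᗮ)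
  obtain ⟨ε, hε, hεη⟩ := exists_dilation_norm_integral_le hθ hT
    (fun k => norm_comp_sub_one_le T (norm_phaseOp_le Y (k : E))) hη
  obtain ⟨g, hg⟩ := exists_dilation χ hε.ne'
  refine ⟨g, fun f hf => opNorm_le_of_inner_le hη.le fun u v => ?_⟩
  rw [norm_inner_symm]
  set w := T.adjoint v
  have hp : Measurable fun q : ↥(Y ⊓ Zᗮ) × Y => ⟪(q.2 : E), ((ε • q.1 : ↥(Y ⊓ Zᗮ)) : E)⟫_ℝ := by
    refine Continuous.measurable ?_
    exact (continuous_subtype_val.comp continuous_snd).inner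
      (continuous_subtype_val.comp (continuous_fst.const_smul ε))
  have hint := integrable_phase_mul hθ (L2.integrable_inner (𝕜 := ℂ) w u) hp
  have h1 : ∀ k : ↥(Y ⊓ Zᗮ), ∫ y : Y, θ k * (Complex.exp (Complex.I *
      ((⟪(y : E), ((ε • k : ↥(Y ⊓ Zᗮ)) : E)⟫_ℝ : ℝ) : ℂ)) * ⟪w y, u y⟫_ℂ) =
      θ k * ⟪w, phaseOp Y ((ε • k : ↥(Y ⊓ Zᗮ)) : E) u⟫_ℂ := by
    intro k
    rw [integral_const_mul, inner_phaseOp]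
  have h2 : ⟪w, mulOp Y f u⟫_ℂ = ∫ k : ↥(Y ⊓ Zᗮ),
      θ k * ⟪w, phaseOp Y ((ε • k : ↥(Y ⊓ Zᗮ)) : E) u⟫_ℂ := by
    simp_rw [← h1]
    rw [integral_integral_swap hint, L2.inner_def]
    refine integral_congr_ae ?_
    filter_upwards [coeFn_mulOp Y f u] with y hy
    simp_rw [← mul_assoc]
    rw [integral_mul_const, hy, hf, hg, ← hχ, RCLike.inner_apply, RCLike.inner_apply, mul_assoc]
    congr 1
    refine integral_congr_ae (Eventually.of_forall fun k => ?_)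
    simp only
    congr 4
    rw [real_inner_smul_left, Submodule.coe_smul, real_inner_smul_right, Submodule.coe_inner,
      inner_perp hZY y k.2.2]
  have h3 : Integrable fun k : ↥(Y ⊓ Zᗮ) =>
      θ k * ⟪w, phaseOp Y ((ε • k : ↥(Y ⊓ Zᗮ)) : E) u⟫_ℂ :=
    hint.integral_prod_left.congr (Eventually.of_forall h1)
  have h4 : ∫ k, θ k = 1 := by
    rw [← hχ0, ← hχ 0]
    simp
  have h5 : ⟪v, (T ∘L mulOp Y f - T) u⟫_ℂ = ∫ k : ↥(Y ⊓ Zᗮ), θ k *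
      ⟪v, (T ∘L (phaseOp Y ((ε • k : ↥(Y ⊓ Zᗮ)) : E) - 1)) u⟫_ℂ := by
    have h6 : ∀ k : ↥(Y ⊓ Zᗮ), θ k * ⟪v, (T ∘L (phaseOp Y ((ε • k : ↥(Y ⊓ Zᗮ)) : E) - 1)) u⟫_ℂ =
        θ k * ⟪w, phaseOp Y ((ε • k : ↥(Y ⊓ Zᗮ)) : E) u⟫_ℂ - θ k * ⟪w, u⟫_ℂ := by
      intro k
      rw [ContinuousLinearMap.comp_apply, ← ContinuousLinearMap.adjoint_inner_left, sub_apply,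
        inner_sub_right, mul_sub]
      rfl
    simp_rw [h6]
    rw [integral_sub h3 (hθ.mul_const _), ← h2, integral_mul_const, h4, one_mul,
      sub_apply, inner_sub_right, ContinuousLinearMap.comp_apply,
      ContinuousLinearMap.adjoint_inner_left, ContinuousLinearMap.adjoint_inner_left]
  rw [h5]
  refine hεη _ _ (by positivity) fun k => ?_
  refine (norm_inner_le_norm _ _).trans ?_
  rw [mul_comm, ← mul_assoc]
  gcongr
  exact ContinuousLinearMap.le_opNorm _ _

/-- Substituting a = x - y exhibits convolution with ρ as the weak average of ρ(a) U_{-a}. -/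
theorem IsConv.inner_apply_eq_integral {ρ : C_c(Y, ℂ)} {A : HilbertL2 Y →L[ℂ] HilbertL2 Y}
    (hA : IsConv (le_refl Y) (le_refl Y) ρ A) (u w : HilbertL2 Y) :
    Integrable (fun a : Y => (starRingEnd ℂ) (ρ a) * ⟪translOp Y (-a) u, w⟫_ℂ) ∧
    ⟪A u, w⟫_ℂ = ∫ a : Y, (starRingEnd ℂ) (ρ a) * ⟪translOp Y (-a) u, w⟫_ℂ := by
  -- The shear (y, a) ↦ (y, y + a) preserves the product measure and carries integrability over to
  -- the variables y and a.
  have hi := (measurePreserving_prod_add (volume : Measure Y) (volume : Measure Y)).integrable_comp_of_integrable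
    (integrable_conv_kernel (le_refl Y) (le_refl Y) ρ u w)
  have hi' : Integrable (fun p : Y × Y => (starRingEnd ℂ) (u p.1) *
      ((starRingEnd ℂ) (ρ p.2) * w (p.1 + p.2))) (volume.prod volume) := by
    refine hi.congr (Eventually.of_forall fun p => ?_)
    change (starRingEnd ℂ) (u p.1) * ((starRingEnd ℂ) (ρ (p.1 + p.2 - p.1)) * w (p.1 + p.2)) = _
    rw [add_sub_cancel_left]
  have h1 : ∀ a : Y, ∫ y : Y, (starRingEnd ℂ) (u y) * ((starRingEnd ℂ) (ρ a) * w (y + a)) =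
      (starRingEnd ℂ) (ρ a) * ⟪translOp Y (-a) u, w⟫_ℂ := by
    intro a
    rw [L2.inner_def, ← integral_const_mul, ← integral_add_right_eq_self
      (fun x : Y => (starRingEnd ℂ) (ρ a) * ⟪translOp Y (-a) u x, w x⟫_ℂ) a]
    refine integral_congr_ae ?_
    filter_upwards [(measurePreserving_add_right volume a).quasiMeasurePreserving.ae
      (coeFn_translOp Y (-a) u)] with y hy
    rw [hy, RCLike.inner_apply, add_neg_cancel_right]
    ring
  refine ⟨hi'.integral_prod_right.congr (Eventually.of_forall h1), ?_⟩
  simp_rw [← h1]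
  rw [← integral_integral_swap hi', hA.hasSections.inner_apply]
  refine integral_congr_ae (Eventually.of_forall fun y => ?_)
  simp only
  rw [RCLike.inner_apply, mul_comm, integral_const_mul]
  congr 1
  rw [L2.inner_def, ← integral_add_left_eq_self _ y]
  refine integral_congr_ae ?_
  filter_upwards [(measurePreserving_add_left volume y).quasiMeasurePreserving.ae
    (coeFn_convSection (le_refl Y) (le_refl Y) ρ y)] with a ha
  rw [ha, RCLike.inner_apply, mul_comm]
  congr 2
  exact congrArg ρ (add_sub_cancel_left y a)

theorem exists_isConv_norm_comp_sub_le {T : HilbertL2 Y →L[ℂ] HilbertL2 X}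
    (hT : Tendsto (fun y : Y => ‖T ∘L (translOp Y y - 1)‖) (𝓝 0) (𝓝 0)) {η : ℝ} (hη : 0 < η) :
    ∃ (ρ : C_c(Y, ℂ)) (A : HilbertL2 Y →L[ℂ] HilbertL2 Y),
      IsConv (le_refl Y) (le_refl Y) ρ A ∧ ‖T ∘L A - T‖ ≤ η := by
  obtain ⟨δ, hδ, hTδ⟩ := Metric.eventually_nhds_iff_ball.1 (hT.eventually (gt_mem_nhds hη))
  -- Only the outer radius matters: the normalized bump lives where ‖T(U_a - 1)‖ < η.
  let b : ContDiffBump (0 : Y) := ⟨δ / 2, δ, half_pos hδ, half_lt_self hδ⟩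
  have hb0 : ∀ a, a ∉ Metric.ball (0 : Y) δ → b.normed volume a = 0 := by
    intro a ha
    rw [← Function.notMem_support, b.support_normed_eq]
    exact ha
  obtain ⟨ρ, hρ⟩ : ∃ ρ : C_c(Y, ℂ), ∀ a, ρ a = (b.normed volume a : ℂ) :=
    ⟨⟨⟨fun a => (b.normed volume a : ℂ), Complex.continuous_ofReal.comp b.continuous_normed⟩,
      b.hasCompactSupport_normed.comp_left (g := Complex.ofReal) Complex.ofReal_zero⟩, fun _ => rfl⟩
  obtain ⟨A, hA⟩ := exists_isConv (le_refl Y) (le_refl Y) ρ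
  refine ⟨ρ, A, hA, opNorm_le_of_inner_le hη.le fun u v => ?_⟩
  obtain ⟨h1, h2⟩ := hA.inner_apply_eq_integral u (T.adjoint v)
  have h3 : ⟪(T ∘L A - T) u, v⟫_ℂ = ∫ a : Y, (b.normed volume a : ℂ) *
      ⟪(T ∘L (translOp Y (-a) - 1)) u, v⟫_ℂ := by
    have h4 : ∀ a : Y, (b.normed volume a : ℂ) * ⟪(T ∘L (translOp Y (-a) - 1)) u, v⟫_ℂ =
        (starRingEnd ℂ) (ρ a) * ⟪translOp Y (-a) u, T.adjoint v⟫_ℂ -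
          (b.normed volume a : ℂ) * ⟪u, T.adjoint v⟫_ℂ := by
      intro a
      rw [hρ, Complex.conj_ofReal, ContinuousLinearMap.comp_apply,
        ← ContinuousLinearMap.adjoint_inner_right, sub_apply, inner_sub_left, mul_sub]
      rfl
    simp_rw [h4]
    have h6 : Integrable fun a : Y => (b.normed volume a : ℂ) * ⟪u, T.adjoint v⟫_ℂ :=
      (show Integrable fun a : Y => ((b.normed volume a : ℝ) : ℂ) from
        b.integrable_normed.ofReal).mul_const _
    rw [integral_sub h1 h6, ← h2, integral_mul_const, integral_complex_ofReal, b.integral_normed, Complex.ofReal_one, one_mul, sub_apply,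
      inner_sub_left, ContinuousLinearMap.comp_apply, ContinuousLinearMap.adjoint_inner_right,
      ContinuousLinearMap.adjoint_inner_right]
  rw [h3]
  have h5 : ‖∫ a : Y, (b.normed volume a : ℂ) * ⟪(T ∘L (translOp Y (-a) - 1)) u, v⟫_ℂ‖ ≤
      ∫ a : Y, b.normed volume a * (η * (‖u‖ * ‖v‖)) := by
    refine norm_integral_le_of_norm_le (b.integrable_normed.mul_const _)
      (Eventually.of_forall fun a => ?_)
    rw [norm_mul, Complex.norm_real, Real.norm_of_nonneg (b.nonneg_normed a)]
    by_cases ha : a ∈ Metric.ball (0 : Y) δ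
    · refine mul_le_mul_of_nonneg_left ?_ (b.nonneg_normed a)
      refine (norm_inner_le_norm _ _).trans ?_
      rw [← mul_assoc]
      gcongr
      refine (ContinuousLinearMap.le_opNorm _ _).trans ?_
      gcongr
      exact (hTδ (-a) (by simpa using ha)).le
    · rw [hb0 a ha, zero_mul, zero_mul]
  refine h5.trans (le_of_eq ?_)
  rw [integral_mul_const, b.integral_normed, one_mul]

/-- The multiplier `x ↦ χ(π_Z x - π_Z y)`. -/
def cut (X Y : Submodule ℝ E) (χ : C_c(Z, ℂ)) (y : Y) : X →ᵇ ℂ :=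
  BoundedContinuousFunction.ofNormedAddCommGroup
    (fun x : X => χ (Z.orthogonalProjectionOnto (x : E) - Z.orthogonalProjectionOnto (y : E)))
    (χ.continuous.comp (((Z.orthogonalProjectionOnto).continuous.comp continuous_subtype_val).sub
      continuous_const))
    (exists_bound_support χ).choose
    fun _ => (exists_bound_support χ).choose_spec.choose_spec.2.2.1 _

theorem cut_apply (χ : C_c(Z, ℂ)) (y : Y) (x : X) : cut X Y χ y x =
    χ (Z.orthogonalProjectionOnto (x : E) - Z.orthogonalProjectionOnto (y : E)) := rfl

/-- Cauchy–Schwarz for |u| and |w|. It gives the bound uniform in z that Fubini needs when phases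
are averaged. -/
theorem integral_norm_inner_le (u w : HilbertL2 Y) : ∫ y : Y, ‖⟪u y, w y⟫_ℂ‖ ≤ ‖u‖ * ‖w‖ := by
  have habs : ∀ f : HilbertL2 Y, ‖absL f‖ ≤ ‖f‖ := fun f => by
    refine Lp.norm_le_norm_of_ae_le ?_
    filter_upwards [coeFn_absL f] with x hx
    rw [hx, Complex.norm_real, norm_norm]
  have h1 : ⟪absL u, absL w⟫_ℂ = ((∫ y : Y, ‖⟪u y, w y⟫_ℂ‖ : ℝ) : ℂ) := by
    rw [L2.inner_def, ← integral_complex_ofReal]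
    refine integral_congr_ae ?_
    filter_upwards [coeFn_absL u, coeFn_absL w] with y h2 h3
    rw [h2, h3, RCLike.inner_apply, RCLike.inner_apply, norm_mul, RCLike.norm_conj,
      Complex.ofReal_mul]
    exact congrArg (_ * ·) (Complex.conj_ofReal _)
  calc ∫ y : Y, ‖⟪u y, w y⟫_ℂ‖ = ‖⟪absL u, absL w⟫_ℂ‖ := by
        rw [h1, Complex.norm_real, Real.norm_of_nonneg (integral_nonneg fun _ => norm_nonneg _)]
    _ ≤ ‖absL u‖ * ‖absL w‖ := norm_inner_le_norm _ _
    _ ≤ ‖u‖ * ‖w‖ := by gcongr <;> exact habs _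

theorem continuous_inner_phaseOp (w u : HilbertL2 X) {ι : Type*} [TopologicalSpace ι]
    [FirstCountableTopology ι] {k : ι → E} (hk : Continuous k) :
    Continuous fun i => ⟪w, phaseOp X (k i) u⟫_ℂ := by
  simp_rw [inner_phaseOp]
  refine continuous_of_dominated (bound := fun x => ‖⟪w x, u x⟫_ℂ‖) (fun i => ?_) (fun i => ?_)
    (L2.integrable_inner (𝕜 := ℂ) w u).norm (Eventually.of_forall fun x => ?_)
  · exact (planeWave X (k i)).continuous.aestronglyMeasurable.mul
      (L2.integrable_inner (𝕜 := ℂ) w u).aestronglyMeasurable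
  · refine Eventually.of_forall fun x => ?_
    rw [norm_mul, mul_comm Complex.I, Complex.norm_exp_ofReal_mul_I, one_mul]
  · have : Continuous fun i => ⟪(x : E), k i⟫_ℝ := continuous_const.inner hk
    fun_prop

theorem norm_adjoint_comp_comp_sub_le {k : E} (S : HilbertL2 Y →L[ℂ] HilbertL2 X) :
    ‖(phaseOp X k).adjoint ∘L S ∘L phaseOp Y k - S‖ ≤ 2 * ‖S‖ := by
  refine (norm_sub_le _ _).trans ?_
  have := norm_comp_comp_le (A := (phaseOp X k).adjoint) (B := phaseOp Y k)
    (by rw [adjoint_phaseOp]; exact norm_phaseOp_le _ _) (norm_phaseOp_le _ _) S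
  linarith

/-- Fourier inversion for the cutoff. Since k takes values in Z, the projections onto Z disappear
from the phases. The conjugate of χ appears because the inner product is conjugate-linear in its
first argument. -/
theorem inner_mulOp_cut {θ : Z → ℂ} (hθ : Integrable θ) {k : Z → E} (hk : Continuous k)
    (hkZ : ∀ z, k z ∈ Z) {χ : C_c(Z, ℂ)} (hχ : ∀ w : Z, (starRingEnd ℂ) (χ w) =
      ∫ z : Z, θ z * Complex.exp (Complex.I * ((⟪(w : E), k z⟫_ℝ : ℝ) : ℂ)))
    (y : Y) (f v : HilbertL2 X) :
    ⟪mulOp X (cut X Y χ y) f, v⟫_ℂ = ∫ z : Z, θ z *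
      (Complex.exp (Complex.I * ((-⟪(y : E), k z⟫_ℝ : ℝ) : ℂ)) * ⟪f, phaseOp X (k z) v⟫_ℂ) := by
  have hproj : ∀ (x : E) (z : Z), ⟪(Z.orthogonalProjectionOnto x : E), k z⟫_ℝ = ⟪x, k z⟫_ℝ := by
    intro x z
    have := Submodule.inner_orthogonalProjectionOnto_eq_of_mem_left ⟨k z, hkZ z⟩ x
    exact (real_inner_comm _ _).trans (this.trans (real_inner_comm _ _))
  have hp : Measurable fun q : Z × X => ⟪(q.2 : E), k q.1⟫_ℝ + -⟪(y : E), k q.1⟫_ℝ := by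
    refine Continuous.measurable ?_
    exact ((continuous_subtype_val.comp continuous_snd).inner (hk.comp continuous_fst)).add
      (continuous_const.inner (hk.comp continuous_fst)).neg
  have hint := integrable_phase_mul hθ (L2.integrable_inner (𝕜 := ℂ) (f) v) hp
  have h1 : ∀ z : Z, θ z * (Complex.exp (Complex.I * ((-⟪(y : E), k z⟫_ℝ : ℝ) : ℂ)) *
      ⟪f, phaseOp X (k z) v⟫_ℂ) = ∫ x : X, θ z * (Complex.exp (Complex.I *
        ((⟪(x : E), k z⟫_ℝ + -⟪(y : E), k z⟫_ℝ : ℝ) : ℂ)) * ⟪f x, v x⟫_ℂ) := by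
    intro z
    rw [integral_const_mul, inner_phaseOp, ← integral_const_mul]
    congr 1
    refine integral_congr_ae (Eventually.of_forall fun x => ?_)
    simp only
    rw [Complex.ofReal_add, mul_add, Complex.exp_add]
    ring
  simp_rw [h1]
  rw [integral_integral_swap hint, L2.inner_def]
  refine integral_congr_ae ?_
  filter_upwards [coeFn_mulOp X (cut X Y χ y) (f)] with x hx
  simp_rw [← mul_assoc]
  rw [integral_mul_const, hx, cut_apply, RCLike.inner_apply, RCLike.inner_apply, map_mul, hχ,
    mul_left_comm]
  congr 1
  refine integral_congr_ae (Eventually.of_forall fun z => ?_)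
  simp only
  rw [Submodule.coe_sub, inner_sub_left, hproj, hproj, sub_eq_add_neg]

theorem integrable_phase_sections {S : HilbertL2 Y →L[ℂ] HilbertL2 X}
    {d : Y → HilbertL2 X} (hd : Continuous d) (hSd : HasSections S d) {θ : Z → ℂ}
    (hθ : Integrable θ) {k : Z → E} (hk : Continuous k) (u : HilbertL2 Y) (v : HilbertL2 X) :
    Integrable (fun q : Z × Y => θ q.1 *
      ⟪Complex.exp (Complex.I * ((⟪(q.2 : E), k q.1⟫_ℝ : ℝ) : ℂ)) * u q.2,
        ⟪d q.2, phaseOp X (k q.1) v⟫_ℂ⟫_ℂ) (volume.prod volume) ∧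
    ∀ z : Z, ∫ y : Y, θ z *
      ⟪Complex.exp (Complex.I * ((⟪(y : E), k z⟫_ℝ : ℝ) : ℂ)) * u y,
        ⟪d y, phaseOp X (k z) v⟫_ℂ⟫_ℂ =
      θ z * ⟪((phaseOp X (k z)).adjoint ∘L S ∘L phaseOp Y (k z)) u, v⟫_ℂ := by
  set F : Z × Y → ℂ := fun q => θ q.1 *
    ⟪Complex.exp (Complex.I * ((⟪(q.2 : E), k q.1⟫_ℝ : ℝ) : ℂ)) * u q.2,
      ⟪d q.2, phaseOp X (k q.1) v⟫_ℂ⟫_ℂ with hF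
  have hFz : ∀ z : Z, (fun y => F (z, y)) =ᵐ[volume]
      fun y => θ z * ⟪phaseOp Y (k z) u y, ⟪d y, phaseOp X (k z) v⟫_ℂ⟫_ℂ := by
    intro z
    filter_upwards [coeFn_phaseOp Y (k z) u] with y hy
    rw [hy]
  have hmeas : AEStronglyMeasurable F (volume.prod volume) := by
    -- Joint measurability of a function continuous in z and measurable in y; this is where
    -- continuity of the columns is used.
    have h1 : StronglyMeasurable
        (Function.uncurry fun (z : Z) (y : Y) => ⟪d y, phaseOp X (k z) v⟫_ℂ) :=
      stronglyMeasurable_uncurry_of_continuous_of_stronglyMeasurable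
        (fun y => continuous_inner_phaseOp (d y) v hk)
        (fun z => (hd.inner continuous_const).stronglyMeasurable)
    have h2 : Continuous fun q : Z × Y =>
        Complex.exp (Complex.I * ((⟪(q.2 : E), k q.1⟫_ℝ : ℝ) : ℂ)) := by
      have : Continuous fun q : Z × Y => ⟪(q.2 : E), k q.1⟫_ℝ :=
        (continuous_subtype_val.comp continuous_snd).inner (hk.comp continuous_fst)
      exact Complex.continuous_exp.comp (continuous_const.mul (Complex.continuous_ofReal.comp this))
    exact hθ.aestronglyMeasurable.comp_fst.mul
      ((h2.aestronglyMeasurable.mul (Lp.aestronglyMeasurable u).comp_snd).inner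
        h1.aestronglyMeasurable)
  have hFint : ∀ z : Z, ∫ y : Y, F (z, y) =
      θ z * ⟪((phaseOp X (k z)).adjoint ∘L S ∘L phaseOp Y (k z)) u, v⟫_ℂ := by
    intro z
    rw [integral_congr_ae (hFz z), integral_const_mul, ← hSd.inner_apply,
      ContinuousLinearMap.comp_apply, ContinuousLinearMap.comp_apply,
      ContinuousLinearMap.adjoint_inner_left]
  refine ⟨?_, hFint⟩
  · rw [integrable_prod_iff hmeas]
    refine ⟨Eventually.of_forall fun z => ?_, ?_⟩
    · exact ((hSd.integrable_inner (phaseOp Y (k z) u) (phaseOp X (k z) v)).const_mul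
        (θ z)).congr (hFz z).symm
    · refine (hθ.norm.mul_const (‖u‖ * (‖S‖ * ‖v‖))).mono'
        hmeas.norm.integral_prod_right' (Eventually.of_forall fun z => ?_)
      rw [Real.norm_of_nonneg (integral_nonneg fun _ => norm_nonneg _)]
      have h1 : ∫ y : Y, ‖F (z, y)‖ = ‖θ z‖ *
          ∫ y : Y, ‖⟪phaseOp Y (k z) u y, S.adjoint (phaseOp X (k z) v) y⟫_ℂ‖ := by
        rw [← integral_const_mul]
        refine integral_congr_ae ?_
        filter_upwards [hFz z, hSd (phaseOp X (k z) v)] with y h2 h3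
        rw [h2, h3, norm_mul]
      have hV : ∀ w : HilbertL2 X, ‖phaseOp X (k z) w‖ ≤ ‖w‖ := fun w => by
        simpa using ContinuousLinearMap.le_of_opNorm_le _ (norm_phaseOp_le X (k z)) w
      have hV' : ∀ w : HilbertL2 Y, ‖phaseOp Y (k z) w‖ ≤ ‖w‖ := fun w => by
        simpa using ContinuousLinearMap.le_of_opNorm_le _ (norm_phaseOp_le Y (k z)) w
      rw [h1]
      gcongr
      refine (integral_norm_inner_le _ _).trans ?_
      gcongr
      · exact hV' u
      · refine (ContinuousLinearMap.le_opNorm _ _).trans ?_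
        rw [LinearIsometryEquiv.norm_map]
        gcongr
        exact hV v

/-- Cutting off the sections of an operator far from the diagonal in the direction of `Z` changes
the operator little. -/
theorem exists_cut_norm_sub_le {S : HilbertL2 Y →L[ℂ] HilbertL2 X}
    {d : Y → HilbertL2 X} (hd : Continuous d) (hSd : HasSections S d)
    (hS : Tendsto (fun z : Z => ‖(phaseOp X (z : E)).adjoint ∘L S ∘L phaseOp Y (z : E) - S‖)
      (𝓝 0) (𝓝 0)) {η : ℝ} (hη : 0 < η) :
    ∃ χ : C_c(Z, ℂ), ∀ S' : HilbertL2 Y →L[ℂ] HilbertL2 X,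
      HasSections S' (fun y => mulOp X (cut X Y χ y) (d y)) → ‖S' - S‖ ≤ η := by
  obtain ⟨θ, hθ, χ₀, hχ0, hχ⟩ := exists_integrable_fourier_compactSupport Z
  obtain ⟨ε, hε, hεη⟩ := exists_dilation_norm_integral_le hθ hS
    (fun k => norm_adjoint_comp_comp_sub_le S) hη
  obtain ⟨χ₁, hχ₁⟩ := exists_dilation χ₀ hε.ne'
  -- The conjugate compensates the conjugate-linearity of the inner product in the column.
  obtain ⟨χ, hχc⟩ : ∃ χ : C_c(Z, ℂ), ∀ w, χ w = (starRingEnd ℂ) (χ₁ w) :=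
    ⟨⟨⟨fun w => (starRingEnd ℂ) (χ₁ w), Complex.continuous_conj.comp χ₁.continuous⟩,
      χ₁.hasCompactSupport.comp_left (map_zero _)⟩, fun _ => rfl⟩
  refine ⟨χ, fun S' hS' => opNorm_le_of_inner_le hη.le fun u v => ?_⟩
  obtain ⟨k, hkdef⟩ : ∃ k : Z → E, ∀ z, k z = ((ε • z : Z) : E) := ⟨_, fun _ => rfl⟩
  have hk : Continuous k := by
    rw [funext hkdef]
    exact continuous_subtype_val.comp (continuous_id.const_smul ε)
  have hkZ : ∀ z, k z ∈ Z := fun z => by rw [hkdef]; exact (ε • z).2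
  have hχk : ∀ w : Z, (starRingEnd ℂ) (χ w) =
      ∫ z : Z, θ z * Complex.exp (Complex.I * ((⟪(w : E), k z⟫_ℝ : ℝ) : ℂ)) := by
    intro w
    rw [hχc, RCLike.conj_conj, hχ₁, ← hχ]
    refine integral_congr_ae (Eventually.of_forall fun z => ?_)
    simp only
    rw [hkdef, real_inner_smul_left, ← real_inner_smul_right]
    rfl
  obtain ⟨hint, hFint⟩ := integrable_phase_sections hd hSd hθ hk u v
  have hFy : ∀ y : Y, ∫ z : Z, θ z *
      ⟪Complex.exp (Complex.I * ((⟪(y : E), k z⟫_ℝ : ℝ) : ℂ)) * u y,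
        ⟪d y, phaseOp X (k z) v⟫_ℂ⟫_ℂ = ⟪u y, ⟪mulOp X (cut X Y χ y) (d y), v⟫_ℂ⟫_ℂ := by
    intro y
    rw [inner_mulOp_cut hθ hk hkZ hχk, RCLike.inner_apply, ← integral_mul_const]
    refine integral_congr_ae (Eventually.of_forall fun z => ?_)
    simp only
    rw [RCLike.inner_apply, map_mul, ← Complex.exp_conj, map_mul, Complex.conj_I,
      Complex.conj_ofReal, Complex.ofReal_neg, mul_neg, neg_mul]
    ring
  have h3 : Integrable fun z : Z =>
      θ z * ⟪((phaseOp X (k z)).adjoint ∘L S ∘L phaseOp Y (k z)) u, v⟫_ℂ :=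
    hint.integral_prod_left.congr (Eventually.of_forall hFint)
  have h4 : ∫ z, θ z = 1 := by
    rw [← hχ0, ← hχ 0]
    simp
  have h5 : ⟪S' u, v⟫_ℂ = ∫ z : Z,
      θ z * ⟪((phaseOp X (k z)).adjoint ∘L S ∘L phaseOp Y (k z)) u, v⟫_ℂ := by
    rw [hS'.inner_apply, ← integral_congr_ae (Eventually.of_forall hFint),
      integral_integral_swap hint]
    exact (integral_congr_ae (Eventually.of_forall hFy)).symm
  have h6 : ⟪(S' - S) u, v⟫_ℂ = ∫ z : Z, θ z *
      ⟪((phaseOp X (k z)).adjoint ∘L S ∘L phaseOp Y (k z) - S) u, v⟫_ℂ := by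
    have h7 : ∀ z : Z, θ z * ⟪((phaseOp X (k z)).adjoint ∘L S ∘L phaseOp Y (k z) - S) u, v⟫_ℂ =
        θ z * ⟪((phaseOp X (k z)).adjoint ∘L S ∘L phaseOp Y (k z)) u, v⟫_ℂ -
          θ z * ⟪S u, v⟫_ℂ := by
      intro z
      rw [sub_apply, inner_sub_left, mul_sub]
    rw [integral_congr_ae (Eventually.of_forall h7), integral_sub h3 (hθ.mul_const _),
      integral_mul_const, h4, one_mul, ← h5, sub_apply, inner_sub_left]
  rw [h6]
  refine hεη _ _ (by positivity) fun z => ?_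
  refine (norm_inner_le_norm _ _).trans ?_
  rw [← mul_assoc, hkdef]
  gcongr
  exact ContinuousLinearMap.le_opNorm _ _

end Averages

end

section

variable {E : Type*} [NormedAddCommGroup E] [InnerProductSpace ℝ E]
  [MeasurableSpace E] [BorelSpace E]

/-! ### Sufficiency: localized covariant columns are approximated by generators. -/

section Sufficiency

variable {X Y Z G : Submodule ℝ E} [FiniteDimensional ℝ X] [FiniteDimensional ℝ Y]
  [FiniteDimensional ℝ Z] [FiniteDimensional ℝ G] {hX : X ≤ G} {hY : Y ≤ G}

theorem convSection_add_coe (hX : X ≤ G) (hY : Y ≤ G) (hZX : Z ≤ X) (hZY : Z ≤ Y) (φ : C_c(G, ℂ))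
    (y : Y) (z : Z) : convSection hX hY φ (y + Submodule.inclusion hZY z) =
      translOp X (-Submodule.inclusion hZX z) (convSection hX hY φ y) := by
  refine Lp.ext ?_
  filter_upwards [coeFn_convSection hX hY φ (y + Submodule.inclusion hZY z),
    coeFn_translOp X (-Submodule.inclusion hZX z) (convSection hX hY φ y),
    (measurePreserving_add_right volume (-Submodule.inclusion hZX z)).quasiMeasurePreserving.ae
      (coeFn_convSection hX hY φ y)] with x h1 h2 h3
  rw [h1, h2, h3]
  congr 1
  refine Subtype.ext ?_
  simp only [Submodule.coe_sub, Submodule.coe_inclusion, Submodule.coe_add, Submodule.coe_neg]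
  abel

theorem mulOp_cut_translOp (hZX : Z ≤ X) (hZY : Z ≤ Y) (χ : C_c(Z, ℂ)) (y : Y) (z : Z)
    (f : HilbertL2 X) : mulOp X (cut X Y χ (y + Submodule.inclusion hZY z))
      (translOp X (-Submodule.inclusion hZX z) f) =
      translOp X (-Submodule.inclusion hZX z) (mulOp X (cut X Y χ y) f) := by
  rw [← ContinuousLinearMap.comp_apply, mulOp_comp_translOp, ContinuousLinearMap.comp_apply]
  congr 3
  ext x
  rw [translBCF_apply, cut_apply, cut_apply, sub_neg_eq_add, Submodule.coe_add, Submodule.coe_add,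
    Submodule.coe_inclusion, Submodule.coe_inclusion, map_add, map_add, add_sub_add_right_eq_sub]

theorem continuous_cut (X Y : Submodule ℝ E) [FiniteDimensional ℝ X] [FiniteDimensional ℝ Y]
    (χ : C_c(Z, ℂ)) : Continuous (cut X Y χ) := by
  have hu := χ.hasCompactSupport.uniformContinuous_of_continuous χ.continuous
  rw [Metric.uniformContinuous_iff] at hu
  rw [Metric.continuous_iff]
  intro y ε hε
  obtain ⟨δ, hδ, h⟩ := hu (ε / 2) (half_pos hε)
  refine ⟨δ, hδ, fun y' hy' => ?_⟩
  refine lt_of_le_of_lt ((BoundedContinuousFunction.dist_le (half_pos hε).le).2 fun x => ?_)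
    (half_lt_self hε)
  rw [cut_apply, cut_apply]
  refine (h ?_).le
  rw [dist_sub_left, dist_eq_norm, ← map_sub]
  refine (Z.norm_orthogonalProjectionOnto_apply_le _).trans_lt ?_
  rw [dist_eq_norm] at hy'
  exact hy'

/-- The functions in `L²(X)` that vanish almost everywhere off `s`. -/
def vanishOff (s : Set X) : Submodule ℂ (HilbertL2 X) where
  carrier := {f | ∀ᵐ x, x ∉ s → f x = 0}
  zero_mem' := by
    filter_upwards [Lp.coeFn_zero ℂ 2 (volume : Measure X)] with x hx _
    rw [hx]; rfl
  add_mem' {f g} hf hg := by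
    filter_upwards [hf, hg, Lp.coeFn_add f g] with x h1 h2 h3 hx
    rw [h3, Pi.add_apply, h1 hx, h2 hx, add_zero]
  smul_mem' c f hf := by
    filter_upwards [hf, Lp.coeFn_smul c f] with x h1 h2 hx
    rw [h2, Pi.smul_apply, h1 hx, smul_zero]

theorem mem_vanishOff {s : Set X} {f : HilbertL2 X} :
    f ∈ vanishOff s ↔ ∀ᵐ x, x ∉ s → f x = 0 := Iff.rfl

theorem mulOp_mem_vanishOff {s : Set X} {b : X →ᵇ ℂ} (hb : ∀ x, x ∉ s → b x = 0)
    (f : HilbertL2 X) : mulOp X b f ∈ vanishOff s := by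
  filter_upwards [coeFn_mulOp X b f] with x h1 hx
  rw [h1, hb x hx, zero_mul]

theorem convSection_mem_vanishOff {s : Set X} {φ : C_c(G, ℂ)} {y : Y}
    (hφ : ∀ x, x ∉ s → φ (Submodule.inclusion hX x - Submodule.inclusion hY y) = 0) :
    convSection hX hY φ y ∈ vanishOff s := by
  filter_upwards [coeFn_convSection hX hY φ y] with x h1 hx
  rw [h1, hφ x hx]

/-- Functions in `L²(X)` localized in the direction of `Z` are approximated by continuous functions
with compact support and similar localization. -/
theorem exists_compactSupport_approx {R : ℝ} {h : HilbertL2 X}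
    (hh : h ∈ vanishOff {x : X | ‖Z.orthogonalProjectionOnto (x : E)‖ ≤ R}) {η : ℝ} (hη : 0 < η) :
    ∃ g : C_c(X, ℂ), (∀ x : X, R + 1 < ‖Z.orthogonalProjectionOnto (x : E)‖ → g x = 0) ∧
      ∀ f : HilbertL2 X, f =ᵐ[volume] g → ‖f - h‖ ≤ η := by
  obtain ⟨g₀, hg₀s, hg₀, hg₀c, hg₀L⟩ := (Lp.memLp h).exists_hasCompactSupport_eLpNorm_sub_le
    ENNReal.ofNat_ne_top (ENNReal.ofReal_pos.2 hη).ne'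
  -- This cutoff is 1 where h lives and 0 beyond R + 1. Since mh = h and 0 ≤ m ≤ 1, multiplying the
  -- approximant by m does not increase the error.
  set m : X → ℝ := fun x => max 0 (min 1 (R + 1 - ‖Z.orthogonalProjectionOnto (x : E)‖)) with hm
  have hmc : Continuous m := by
    have : Continuous fun x : X => ‖Z.orthogonalProjectionOnto (x : E)‖ :=
      (Z.orthogonalProjectionOnto.continuous.comp continuous_subtype_val).norm
    exact continuous_const.max (continuous_const.min (continuous_const.sub this))
  have hm0 : ∀ x, 0 ≤ m x := fun x => le_max_left _ _
  have hm1 : ∀ x, m x ≤ 1 := fun x => max_le zero_le_one (min_le_left _ _)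
  refine ⟨⟨⟨fun x => (m x : ℂ) * g₀ x, (Complex.continuous_ofReal.comp hmc).mul hg₀c⟩,
    hg₀s.mul_left⟩, fun x hx => ?_, fun f hf => ?_⟩
  · change (m x : ℂ) * g₀ x = 0
    have : m x = 0 := max_eq_left ((min_le_right _ _).trans (by linarith))
    rw [this, Complex.ofReal_zero, zero_mul]
  · rw [norm_sub_rev, Lp.norm_def]
    refine ENNReal.toReal_le_of_le_ofReal hη.le (le_trans (eLpNorm_mono_ae ?_) hg₀)
    filter_upwards [Lp.coeFn_sub h f, hf, hh] with x h1 h2 h3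
    rw [h1, Pi.sub_apply, h2]
    change ‖h x - (m x : ℂ) * g₀ x‖ ≤ ‖h x - g₀ x‖
    have h4 : h x = (m x : ℂ) * h x := by
      by_cases hx : ‖Z.orthogonalProjectionOnto (x : E)‖ ≤ R
      · have : m x = 1 := by
          rw [hm]
          simp only
          rw [min_eq_left (by linarith), max_eq_right zero_le_one]
        rw [this, Complex.ofReal_one, one_mul]
      · rw [h3 hx, mul_zero]
    have h5 : h x - (m x : ℂ) * g₀ x = (m x : ℂ) * (h x - g₀ x) := by rw [mul_sub, ← h4]
    rw [h5, norm_mul, Complex.norm_real, Real.norm_of_nonneg (hm0 x)]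
    exact mul_le_of_le_one_left (norm_nonneg _) (hm1 x)

/-- Extension of a function with compact support from `X` to `G`. -/
theorem exists_extension (hX : X ≤ G) (g : C_c(X, ℂ)) : ∃ φ : C_c(G, ℂ),
    (∀ x, φ (Submodule.inclusion hX x) = g x) ∧
    ∀ v : G, g (X.orthogonalProjectionOnto (v : E)) = 0 → φ v = 0 := by
  have hP : Continuous fun v : G => X.orthogonalProjectionOnto (v : E) :=
    X.orthogonalProjectionOnto.continuous.comp continuous_subtype_val
  set b : G → ℝ := fun v => max 0 (1 - ‖(v : E) - X.orthogonalProjectionOnto (v : E)‖) with hb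
  have hbc : Continuous b :=
    continuous_const.max (continuous_const.sub
      (continuous_subtype_val.sub (continuous_subtype_val.comp hP)).norm)
  obtain ⟨-, r, -, hr0, -, hr⟩ := exists_bound_support g
  refine ⟨⟨⟨fun v => (b v : ℂ) * g (X.orthogonalProjectionOnto (v : E)),
    (Complex.continuous_ofReal.comp hbc).mul (g.continuous.comp hP)⟩, ?_⟩, fun x => ?_, fun v hv => ?_⟩
  · refine HasCompactSupport.of_support_subset_isCompact (isCompact_closedBall (0 : G) (1 + r))
      fun v hv => ?_
    have h1 : b v ≠ 0 := fun h => hv (by simp [h])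
    have h2 : g (X.orthogonalProjectionOnto (v : E)) ≠ 0 := fun h => hv (by simp [h])
    have h3 : ‖(v : E) - X.orthogonalProjectionOnto (v : E)‖ ≤ 1 := by
      by_contra h
      exact h1 (max_eq_left (by linarith))
    have h4 : ‖X.orthogonalProjectionOnto (v : E)‖ ≤ r := by
      by_contra h
      exact h2 (hr _ (not_le.1 h))
    rw [mem_closedBall_zero_iff]
    have h5 := norm_add_le ((v : E) - X.orthogonalProjectionOnto (v : E))
      (X.orthogonalProjectionOnto (v : E) : E)
    rw [sub_add_cancel] at h5
    exact h5.trans (add_le_add h3 h4)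
  · have h1 : X.orthogonalProjectionOnto ((Submodule.inclusion hX x : G) : E) = x :=
      X.orthogonalProjectionOnto_mem_subspace_eq_self x
    change (b (Submodule.inclusion hX x) : ℂ) *
      g (X.orthogonalProjectionOnto ((Submodule.inclusion hX x : G) : E)) = g x
    rw [hb]
    simp only
    rw [h1, Submodule.coe_inclusion, sub_self, norm_zero, sub_zero, max_eq_right zero_le_one,
      Complex.ofReal_one, one_mul]
  · change (b v : ℂ) * g (X.orthogonalProjectionOnto (v : E)) = 0
    rw [hv, mul_zero]

theorem orthogonalProjectionOnto_orthogonalProjectionOnto (hZX : Z ≤ X) (v : E) :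
    Z.orthogonalProjectionOnto (X.orthogonalProjectionOnto v : E) =
      Z.orthogonalProjectionOnto v := by
  have h : v - X.orthogonalProjectionOnto v ∈ Zᗮ :=
    Submodule.orthogonal_le hZX (X.sub_starProjection_mem_orthogonal v)
  have h1 := (Submodule.orthogonalProjectionOnto_eq_zero_iff).2 h
  rw [map_sub, sub_eq_zero] at h1
  exact h1.symm

/-- Extend a compactly supported approximant from X to G, then shift by y₀. The shift is orthogonal
to Z, so localization in that direction survives; it then controls the columns of T_{XY}(φ) at every
y, not only at y₀. -/
theorem exists_convSection_approx (hX : X ≤ G) (hY : Y ≤ G) (hZX : Z ≤ X) {R : ℝ}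
    {h : HilbertL2 X} {y₀ : Y} (hy₀ : (y₀ : E) ∈ Zᗮ)
    (hh : h ∈ vanishOff {x : X | ‖Z.orthogonalProjectionOnto (x : E)‖ ≤ R}) {η : ℝ} (hη : 0 < η) :
    ∃ φ : C_c(G, ℂ), ‖convSection hX hY φ y₀ - h‖ ≤ η ∧
      ∀ v : G, R + 1 < ‖Z.orthogonalProjectionOnto (v : E)‖ → φ v = 0 := by
  obtain ⟨g, hg, hgh⟩ := exists_compactSupport_approx hh hη
  obtain ⟨φ, hφg, hφ0⟩ := exists_extension hX g
  refine ⟨shift φ (Submodule.inclusion hY y₀), hgh _ ?_, fun v hv => ?_⟩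
  · filter_upwards [coeFn_convSection hX hY (shift φ (Submodule.inclusion hY y₀)) y₀] with x hx
    rw [hx, shift_apply, sub_add_cancel, hφg]
  · rw [shift_apply]
    refine hφ0 _ (hg _ ?_)
    rw [orthogonalProjectionOnto_orthogonalProjectionOnto hZX, Submodule.coe_add, map_add,
      Submodule.coe_inclusion, (Submodule.orthogonalProjectionOnto_eq_zero_iff).2 hy₀, add_zero]
    exact hv

/-- Pairs `(y, x)` that are close in the direction of `Z`, with `y` close to `Z`. -/
def nearSet (X : Submodule ℝ E) (hZY : Z ≤ Y) (R R' : ℝ) : Set (Y × X) :=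
  {p | ‖Z.orthogonalProjectionOnto (p.2 : E) - Z.orthogonalProjectionOnto (p.1 : E)‖ ≤ R ∧
    ‖perp hZY p.1‖ ≤ R'}

theorem measurableSet_nearSet (hZY : Z ≤ Y) (R R' : ℝ) :
    MeasurableSet (nearSet X hZY R R') := by
  have h1 : Continuous fun p : Y × X => Z.orthogonalProjectionOnto (p.2 : E) :=
    Z.orthogonalProjectionOnto.continuous.comp (continuous_subtype_val.comp continuous_snd)
  have h2 : Continuous fun p : Y × X => Z.orthogonalProjectionOnto (p.1 : E) :=
    Z.orthogonalProjectionOnto.continuous.comp (continuous_subtype_val.comp continuous_fst)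
  exact ((isClosed_le (h1.sub h2).norm continuous_const).inter
    (isClosed_le ((continuous_perp hZY).comp continuous_fst).norm continuous_const)).measurableSet

/-- Two such y differ by at most 2R along Z, both being near the projection of x, and by at most 2R'
orthogonally to Z. -/
theorem volume_nearSet_le (hZY : Z ≤ Y) (R R' : ℝ) (x : X) :
    volume {y | (y, x) ∈ nearSet X hZY R R'} ≤ ballVol Y (2 * R + 2 * R') := by
  refine volume_le_ballVol Y fun a ha b hb => ?_
  obtain ⟨ha1, ha2⟩ := ha
  obtain ⟨hb1, hb2⟩ := hb
  have h1 : ((a - b : Y) : E) = (Z.orthogonalProjectionOnto (a : E) -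
      Z.orthogonalProjectionOnto (b : E) : Z) + ((perp hZY a - perp hZY b : ↥(Y ⊓ Zᗮ)) : E) := by
    rw [Submodule.coe_sub, Submodule.coe_sub, Submodule.coe_sub, coe_perp, coe_perp,
      Submodule.starProjection_apply, Submodule.starProjection_apply]
    abel
  have h2 : ‖Z.orthogonalProjectionOnto (a : E) - Z.orthogonalProjectionOnto (b : E)‖ ≤ 2 * R := by
    rw [← sub_sub_sub_cancel_left _ _ (Z.orthogonalProjectionOnto (x : E))]
    exact (norm_sub_le _ _).trans (by linarith)
  have h3 : ‖perp hZY a - perp hZY b‖ ≤ 2 * R' := (norm_sub_le _ _).trans (by linarith)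
  change ‖((a - b : Y) : E)‖ ≤ _
  rw [h1]
  exact (norm_add_le _ _).trans (add_le_add h2 h3)

/-- Localized sections with the covariance of an operator that commutes with the translations by
`Z`, multiplied by a function with compact support on `Y/Z`, define elements of `𝒞_{XY}(Z)`. -/
theorem mem_couplingSpace_of_hasSections (hZX : Z ≤ X) (hZY : Z ≤ Y) {h : Y → HilbertL2 X}
    (hc : Continuous h) (hcov : ∀ (y : Y) (z : Z), h (y + Submodule.inclusion hZY z) =
      translOp X (-Submodule.inclusion hZX z) (h y)) {R : ℝ}
    (hloc : ∀ y : Y, h y ∈ vanishOff {x : X | ‖Z.orthogonalProjectionOnto (x : E) -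
      Z.orthogonalProjectionOnto (y : E)‖ ≤ R}) (g : C_c(↥(Y ⊓ Zᗮ), ℂ))
    {S : HilbertL2 Y →L[ℂ] HilbertL2 X}
    (hS : HasSections S fun y => g (perp hZY y) • h y) :
    S ∈ couplingSpace X Y G Z hX hY := by
  obtain ⟨M, R', hM, hR', hgM, hgR'⟩ := exists_bound_support g
  set C := ballVol Y (2 * (R + 1) + 2 * R')
  have hcl : IsClosed (couplingSpace X Y G Z hX hY : Set (HilbertL2 Y →L[ℂ] HilbertL2 X)) :=
    Submodule.isClosed_topologicalClosure _
  rw [← SetLike.mem_coe, ← hcl.closure_eq, Metric.mem_closure_iff]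
  intro ε hε
  -- Columns will differ by at most Mη, so the Schur-type bound gives Mη√C < ε.
  set η := ε / (2 * (M * √C + 1)) with hη_def
  have hη : 0 < η := by positivity
  let ι : ↥(Y ⊓ Zᗮ) → Y := Submodule.inclusion inf_le_left
  have hι : Continuous ι := (isometry_inclusion (inf_le_left : Y ⊓ Zᗮ ≤ Y)).continuous
  have hP0 : ∀ w : ↥(Y ⊓ Zᗮ), Z.orthogonalProjectionOnto ((ι w : Y) : E) = 0 := fun w =>
    (Submodule.orthogonalProjectionOnto_eq_zero_iff).2 w.2.2
  have happrox : ∀ w : ↥(Y ⊓ Zᗮ), ∃ φ : C_c(G, ℂ), ‖convSection hX hY φ (ι w) - h (ι w)‖ ≤ η / 2 ∧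
      ∀ v : G, R + 1 < ‖Z.orthogonalProjectionOnto (v : E)‖ → φ v = 0 := by
    intro w
    refine exists_convSection_approx hX hY hZX w.2.2 ?_ (half_pos hη)
    have := hloc (ι w)
    simpa only [hP0 w, sub_zero] using this
  choose φ hφη hφ0 using happrox
  let U : ↥(Y ⊓ Zᗮ) → Set ↥(Y ⊓ Zᗮ) := fun w =>
    {w' | ‖convSection hX hY (φ w) (ι w') - h (ι w')‖ < η}
  have hU : ∀ w, IsOpen (U w) := fun w =>
    isOpen_lt (((continuous_convSection hX hY (φ w)).comp hι).sub (hc.comp hι)).norm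
      continuous_const
  obtain ⟨t, ht⟩ := g.hasCompactSupport.isCompact.elim_finite_subcover U hU fun w _ =>
    Set.mem_iUnion.2 ⟨w, (hφη w).trans_lt (half_lt_self hη)⟩
  let e := t.equivFin
  obtain ⟨f, hfU, hf1, hf01, hfc⟩ := exists_continuous_sum_one_of_isOpen_isCompact
    (s := fun i => U (e.symm i)) (fun i => hU _) g.hasCompactSupport.isCompact (by
      intro w hw
      obtain ⟨w', hw't, hw'⟩ := Set.mem_iUnion₂.1 (ht hw)
      exact Set.mem_iUnion.2 ⟨e ⟨w', hw't⟩, by simpa using hw'⟩)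
  obtain ⟨gi, hgi⟩ : ∃ gi : Fin t.card → C_c(↥(Y ⊓ Zᗮ), ℂ), ∀ i w, gi i w = (f i w : ℂ) * g w :=
    ⟨fun i => ⟨⟨fun w => (f i w : ℂ) * g w,
      (Complex.continuous_ofReal.comp (f i).continuous).mul g.continuous⟩,
      g.hasCompactSupport.mul_left⟩, fun _ _ => rfl⟩
  choose ψ hψ using fun i => exists_liftQuot_eq hZY (gi i)
  choose A hA using fun i => exists_isConv hX hY (φ (e.symm i))
  refine ⟨∑ i, A i ∘L mulOp Y (liftQuot Y Z (ψ i)),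
    Submodule.sum_mem _ fun i _ => mem_couplingSpace (hA i) (ψ i), ?_⟩
  have hsec := hS.sub (HasSections.sum Finset.univ fun i _ =>
    (hA i).hasSections.comp_mulOp Y (liftQuot Y Z (ψ i)))
  have hdiff : ∀ y i, ‖h y - convSection hX hY (φ (e.symm i)) y‖ * f i (perp hZY y) ≤
      η * f i (perp hZY y) := by
    intro y i
    by_cases hfi : f i (perp hZY y) = 0
    · rw [hfi, mul_zero, mul_zero]
    · refine mul_le_mul_of_nonneg_right ?_ (hf01 i _).1
      have h1 : perp hZY y ∈ U (e.symm i) := hfU i (subset_tsupport _ hfi)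
      -- By covariance the error at y is a unitary translate of the error at y^⊥, where the choice
      -- of the open cover applies.
      have h2 : y = ι (perp hZY y) +
          Submodule.inclusion hZY (Z.orthogonalProjectionOnto (y : E)) := by
        refine Subtype.ext ?_
        rw [Submodule.coe_add, Submodule.coe_inclusion, Submodule.coe_inclusion, coe_perp,
          Submodule.starProjection_apply, sub_add_cancel]
      rw [h2, hcov, convSection_add_coe hX hY hZX hZY, ← map_sub]
      refine (ContinuousLinearMap.le_of_opNorm_le _ (norm_translOp_le X _) _).trans ?_
      rw [one_mul, norm_sub_rev]
      exact h1.le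
  have hbound : ∀ y, ‖g (perp hZY y) • h y - ∑ i, liftQuot Y Z (ψ i) y •
      convSection hX hY (φ (e.symm i)) y‖ ≤ M * η := by
    intro y
    by_cases hg0 : g (perp hZY y) = 0
    · simp only [hψ, hgi, hg0, mul_zero, zero_smul, Finset.sum_const_zero, sub_zero, norm_zero]
      positivity
    · have h1 : ∑ i, f i (perp hZY y) = 1 := by
        have := hf1 (subset_tsupport _ hg0)
        simpa using this
      have h2 : g (perp hZY y) • h y = ∑ i, liftQuot Y Z (ψ i) y • h y := by
        simp only [hψ, hgi]
        rw [← Finset.sum_smul, ← Finset.sum_mul, ← Complex.ofReal_sum, h1, Complex.ofReal_one,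
          one_mul]
      rw [h2, ← Finset.sum_sub_distrib]
      calc ‖∑ i, (liftQuot Y Z (ψ i) y • h y - liftQuot Y Z (ψ i) y •
            convSection hX hY (φ (e.symm i)) y)‖
          ≤ ∑ i, M * (η * f i (perp hZY y)) := by
            refine norm_sum_le_of_le _ fun i _ => ?_
            rw [← smul_sub, norm_smul, hψ, hgi, norm_mul, Complex.norm_real,
              Real.norm_of_nonneg (hf01 i _).1, mul_comm (f i _), mul_assoc, mul_comm (f i _)]
            exact mul_le_mul (hgM _) (hdiff y i)
              (mul_nonneg (norm_nonneg _) (hf01 i _).1) hM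
        _ = M * η := by rw [← Finset.mul_sum, ← Finset.mul_sum, h1, mul_one]
  have hsupp : ∀ y, g (perp hZY y) • h y - ∑ i, liftQuot Y Z (ψ i) y •
      convSection hX hY (φ (e.symm i)) y ∈ vanishOff {x | (y, x) ∈ nearSet X hZY (R + 1) R'} := by
    intro y
    by_cases hy : ‖perp hZY y‖ ≤ R'
    · refine Submodule.sub_mem _ (Submodule.smul_mem _ _ ?_)
        (Submodule.sum_mem _ fun i _ => Submodule.smul_mem _ _ ?_)
      · refine mem_vanishOff.2 ?_
        filter_upwards [hloc y] with x h1 h2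
        refine h1 fun h3 => h2 ⟨?_, hy⟩
        have : ‖Z.orthogonalProjectionOnto (x : E) - Z.orthogonalProjectionOnto (y : E)‖ ≤ R := h3
        linarith
      · refine convSection_mem_vanishOff fun x hx => hφ0 _ _ ?_
        rw [← not_le]
        refine fun h3 => hx ⟨?_, hy⟩
        rw [Submodule.coe_sub, map_sub] at h3
        exact h3
    · have hg0 := hgR' _ (not_le.1 hy)
      simp only [hψ, hgi, hg0, mul_zero, zero_smul, Finset.sum_const_zero, sub_zero]
      exact Submodule.zero_mem _
  have hnorm := hsec.norm_le (M := M * η * √C) (by positivity)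
    (eLpNorm_inner_le_of_localized (measurableSet_nearSet hZY (R + 1) R') (by positivity) hbound
      hsupp (volume_nearSet_le hZY (R + 1) R'))
  rw [dist_eq_norm]
  refine hnorm.trans_lt ?_
  calc M * η * √C = ε / 2 * (M * √C / (M * √C + 1)) := by rw [hη_def]; field_simp
    _ ≤ ε / 2 * 1 := by
      gcongr
      rw [div_le_one (by positivity)]
      linarith
    _ < ε := by linarith

/-- Multiplication by b commutes with V_z and V_z^*(TA)V_z = (V_z^*TV_z)(V_z^*AV_z), so the
regularized operator keeps the phase condition needed for the cutoff along Z. -/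
theorem tendsto_phaseOp_conj_comp_mulOp {T : HilbertL2 Y →L[ℂ] HilbertL2 X}
    {A : HilbertL2 Y →L[ℂ] HilbertL2 Y}
    (hphase : Tendsto (fun z : Z => ‖(phaseOp X (z : E)).adjoint ∘L T ∘L
      phaseOp Y (z : E) - T‖) (𝓝 0) (𝓝 0))
    (hA : Tendsto (fun z : Z => ‖(phaseOp Y (z : E)).adjoint ∘L A ∘L
      phaseOp Y (z : E) - A‖) (𝓝 0) (𝓝 0)) (b : Y →ᵇ ℂ) :
    Tendsto (fun z : Z => ‖(phaseOp X (z : E)).adjoint ∘L ((T ∘L A) ∘L mulOp Y b) ∘L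
      phaseOp Y (z : E) - (T ∘L A) ∘L mulOp Y b‖) (𝓝 0) (𝓝 0) := by
  have h1 := tendsto_norm_comp_right hphase
    (B := fun z : Z => (phaseOp Y (z : E)).adjoint ∘L A ∘L phaseOp Y (z : E)) (M := ‖A‖)
    fun z => norm_comp_comp_le (by rw [adjoint_phaseOp]; exact norm_phaseOp_le _ _)
      (norm_phaseOp_le _ _) A
  have h2 := tendsto_norm_comp_left T hA
  refine (tendsto_norm_comp_right (tendsto_norm_add h1 h2)
    (fun _ => le_refl ‖mulOp Y b‖)).congr fun z => ?_
  congr 1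
  have h3 : ((phaseOp X (z : E)).adjoint ∘L T ∘L phaseOp Y (z : E)) ∘L
      (phaseOp Y (z : E)).adjoint ∘L A ∘L phaseOp Y (z : E) =
      (phaseOp X (z : E)).adjoint ∘L T ∘L A ∘L phaseOp Y (z : E) := by
    have h4 : phaseOp Y (z : E) ∘L (phaseOp Y (z : E)).adjoint = 1 := by
      rw [adjoint_phaseOp, phaseOp_comp_neg]
    rw [ContinuousLinearMap.comp_assoc, ContinuousLinearMap.comp_assoc,
      ← ContinuousLinearMap.comp_assoc (phaseOp Y (z : E)), h4]
    rfl
  have h5 : ((T ∘L A) ∘L mulOp Y b) ∘L phaseOp Y (z : E) = (T ∘L A ∘L phaseOp Y (z : E)) ∘L mulOp Y b := by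
    rw [ContinuousLinearMap.comp_assoc (T ∘L A), mulOp_comp_phaseOp]
    rfl
  rw [h5, ContinuousLinearMap.sub_comp, h3, ContinuousLinearMap.comp_sub, sub_add_sub_cancel,
    ContinuousLinearMap.sub_comp]
  rfl

/-- Invariance of T under U_z makes the columns covariant, χ localizes them along Z and g across it.
The two cutoffs alone guarantee a bounded operator. -/
theorem exists_mem_couplingSpace_hasSections (hZX : Z ≤ X) (hZY : Z ≤ Y)
    {T : HilbertL2 Y →L[ℂ] HilbertL2 X}
    (hinv : ∀ z : Z, (translOp X (Submodule.inclusion hZX z)).adjoint ∘L T ∘L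
      translOp Y (Submodule.inclusion hZY z) = T) (ρ : C_c(Y, ℂ)) (χ : C_c(Z, ℂ))
    (g : C_c(↥(Y ⊓ Zᗮ), ℂ)) :
    ∃ S' ∈ couplingSpace X Y G Z hX hY, HasSections S' fun y => g (perp hZY y) •
      mulOp X (cut X Y χ y) (T (convSection (le_refl Y) (le_refl Y) ρ y)) := by
  have hTc : Continuous fun y => T (convSection (le_refl Y) (le_refl Y) ρ y) :=
    T.continuous.comp (continuous_convSection _ _ ρ)
  set h : Y → HilbertL2 X := fun y =>
    mulOp X (cut X Y χ y) (T (convSection (le_refl Y) (le_refl Y) ρ y)) with hh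
  have hhc : Continuous h := ((continuous_mulOp X).comp (continuous_cut X Y χ)).clm_apply hTc
  have hcomm : ∀ z : Z, T ∘L translOp Y (Submodule.inclusion hZY z) =
      translOp X (Submodule.inclusion hZX z) ∘L T := by
    intro z
    conv_rhs => rw [← hinv z, adjoint_translOp, ← ContinuousLinearMap.comp_assoc,
      translOp_comp_neg]
    rfl
  have hcov : ∀ (y : Y) (z : Z), h (y + Submodule.inclusion hZY z) =
      translOp X (-Submodule.inclusion hZX z) (h y) := by
    intro y z
    have h1 := hcomm (-z)
    rw [map_neg, map_neg] at h1
    simp only [hh]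
    rw [convSection_add_coe (le_refl Y) (le_refl Y) hZY hZY, ← mulOp_cut_translOp hZX hZY,
      ← ContinuousLinearMap.comp_apply T, h1, ContinuousLinearMap.comp_apply]
  obtain ⟨c, R, hc, hR, hχc, hχR⟩ := exists_bound_support χ
  have hloc : ∀ y : Y, h y ∈ vanishOff {x : X | ‖Z.orthogonalProjectionOnto (x : E) -
      Z.orthogonalProjectionOnto (y : E)‖ ≤ R} := fun y =>
    mulOp_mem_vanishOff (fun x hx => hχR _ (not_le.1 hx)) _
  obtain ⟨M, R', hM, hR', hgM, hgR'⟩ := exists_bound_support g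
  obtain ⟨r, r', hr, hr', hρr, hρr'⟩ := exists_bound_support ρ
  have hbound : ∀ y, ‖g (perp hZY y) • h y‖ ≤
      M * (c * (‖T‖ * (r * √(ballVol Y (2 * r'))))) := by
    intro y
    rw [norm_smul]
    have h1 : ‖mulOp X (cut X Y χ y)‖ ≤ c :=
      (norm_mulOp_le X _).trans ((BoundedContinuousFunction.norm_le hc).2 fun x => hχc _)
    have h2 := norm_convSection_le (le_refl Y) (le_refl Y) ρ y hr hρr hρr'
    refine mul_le_mul (hgM _) ?_ (norm_nonneg _) hM
    refine (ContinuousLinearMap.le_of_opNorm_le _ h1 _).trans ?_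
    gcongr
    exact (ContinuousLinearMap.le_opNorm _ _).trans (by gcongr)
  have hsupp : ∀ y, g (perp hZY y) • h y ∈ vanishOff {x | (y, x) ∈ nearSet X hZY R R'} := by
    intro y
    by_cases hy : ‖perp hZY y‖ ≤ R'
    · refine Submodule.smul_mem _ _ (mem_vanishOff.2 ?_)
      filter_upwards [hloc y] with x h1 h2
      exact h1 fun h3 => h2 ⟨h3, hy⟩
    · rw [hgR' _ (not_le.1 hy), zero_smul]
      exact Submodule.zero_mem _
  obtain ⟨S', hS'⟩ := exists_hasSections (ν := (volume : Measure Y))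
    (d := fun y => g (perp hZY y) • h y)
    (fun v => (((g.continuous.comp (continuous_perp hZY)).smul hhc).inner
      continuous_const).aestronglyMeasurable) (by positivity)
    (eLpNorm_inner_le_of_localized (measurableSet_nearSet hZY R R') (by positivity) hbound
      hsupp (volume_nearSet_le hZY R R'))
  exact ⟨S', mem_couplingSpace_of_hasSections hZX hZY hhc hcov hloc g hS', hS'⟩

theorem mem_couplingSpace_of_tendsto (hZX : Z ≤ X) (hZY : Z ≤ Y)
    {T : HilbertL2 Y →L[ℂ] HilbertL2 X}
    (hinv : ∀ z : Z, (translOp X (Submodule.inclusion hZX z)).adjoint ∘L T ∘L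
      translOp Y (Submodule.inclusion hZY z) = T)
    (hphase : Tendsto (fun z : Z => ‖(phaseOp X (z : E)).adjoint ∘L T ∘L
      phaseOp Y (z : E) - T‖) (𝓝 0) (𝓝 0))
    (htransl : Tendsto (fun y : Y => ‖T ∘L (translOp Y y - 1)‖) (𝓝 0) (𝓝 0))
    (hperp : Tendsto (fun k : ↥(Y ⊓ Zᗮ) => ‖T ∘L (phaseOp Y (k : E) - 1)‖) (𝓝 0) (𝓝 0)) :
    T ∈ couplingSpace X Y G Z hX hY := by
  have hcl : IsClosed (couplingSpace X Y G Z hX hY : Set (HilbertL2 Y →L[ℂ] HilbertL2 X)) :=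
    Submodule.isClosed_topologicalClosure _
  rw [← SetLike.mem_coe, ← hcl.closure_eq, Metric.mem_closure_iff]
  intro ε hε
  obtain ⟨g, hg⟩ := exists_cutoff_norm_comp_sub_le hZY hperp (show 0 < ε / 4 by positivity)
  obtain ⟨ψ, hψ⟩ := exists_liftQuot_eq hZY g
  set B := mulOp Y (liftQuot Y Z ψ)
  have hB : ‖T ∘L B - T‖ ≤ ε / 4 := hg _ hψ
  -- The cutoff B is fixed before ρ, since the error (TA - T)B is controlled through ‖B‖.
  have hη : 0 < ε / (4 * (‖B‖ + 1)) := by positivity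
  obtain ⟨ρ, A, hA, hTA⟩ := exists_isConv_norm_comp_sub_le htransl hη
  set S := (T ∘L A) ∘L B
  have hS1 : ‖S - T ∘L B‖ ≤ ε / 4 := by
    calc ‖S - T ∘L B‖ = ‖(T ∘L A - T) ∘L B‖ := by rw [ContinuousLinearMap.sub_comp]
      _ ≤ ε / (4 * (‖B‖ + 1)) * (‖B‖ + 1) :=
        (ContinuousLinearMap.opNorm_comp_le _ _).trans (by gcongr; linarith)
      _ = ε / 4 := by field_simp
  have hSd : HasSections S fun y => liftQuot Y Z ψ y • T (convSection (le_refl Y) (le_refl Y) ρ y) :=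
    (hA.hasSections.comp_left T).comp_mulOp Y _
  have hTc : Continuous fun y => T (convSection (le_refl Y) (le_refl Y) ρ y) :=
    T.continuous.comp (continuous_convSection _ _ ρ)
  have hSphase := tendsto_phaseOp_conj_comp_mulOp hphase
    (tendsto_phaseOp_conj_of_isConv (Z := Z) hA) (liftQuot Y Z ψ)
  obtain ⟨χ, hχ⟩ := exists_cut_norm_sub_le
    ((liftQuot Y Z ψ).continuous.smul hTc) hSd hSphase (show 0 < ε / 4 by positivity)
  obtain ⟨S', hS'mem, hS'⟩ :=
    exists_mem_couplingSpace_hasSections (hX := hX) (hY := hY) hZX hZY hinv ρ χ g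
  refine ⟨S', hS'mem, ?_⟩
  have hS'S : ‖S' - S‖ ≤ ε / 4 := by
    refine hχ S' ?_
    have h1 : (fun y => mulOp X (cut X Y χ y) (liftQuot Y Z ψ y •
        T (convSection (le_refl Y) (le_refl Y) ρ y))) = fun y => g (perp hZY y) •
        mulOp X (cut X Y χ y) (T (convSection (le_refl Y) (le_refl Y) ρ y)) := by
      funext y
      rw [ContinuousLinearMap.map_smul, hψ]
    exact h1 ▸ hS'
  rw [dist_eq_norm, norm_sub_rev]
  calc ‖S' - T‖ = ‖(S' - S) + (S - T ∘L B) + (T ∘L B - T)‖ := by congr 1; abel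
    _ ≤ ‖S' - S‖ + ‖S - T ∘L B‖ + ‖T ∘L B - T‖ := norm_add₃_le
    _ < ε := by linarith

end Sufficiency

end

section

/-! ### Passage to adjoints and the characterization by condition 3. -/

section Adjoint

variable {E : Type*} [NormedAddCommGroup E] [InnerProductSpace ℝ E]
  [MeasurableSpace E] [BorelSpace E]
  {X Y Z G : Submodule ℝ E} [FiniteDimensional ℝ X] [FiniteDimensional ℝ Y]
  [FiniteDimensional ℝ Z] [FiniteDimensional ℝ G] {hX : X ≤ G} {hY : Y ≤ G}

theorem adjoint_conj (A : HilbertL2 X →L[ℂ] HilbertL2 X) (T : HilbertL2 Y →L[ℂ] HilbertL2 X)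
    (B : HilbertL2 Y →L[ℂ] HilbertL2 Y) :
    (A.adjoint ∘L T ∘L B).adjoint = B.adjoint ∘L T.adjoint ∘L A := by
  rw [ContinuousLinearMap.adjoint_comp, ContinuousLinearMap.adjoint_comp,
    ContinuousLinearMap.adjoint_adjoint, ContinuousLinearMap.comp_assoc]

theorem norm_adjoint_comp_sub_one (T : HilbertL2 Y →L[ℂ] HilbertL2 X)
    (A : HilbertL2 X →L[ℂ] HilbertL2 X) :
    ‖T.adjoint ∘L (A - 1)‖ = ‖(A.adjoint - 1) ∘L T‖ := by
  rw [← LinearIsometryEquiv.norm_map ContinuousLinearMap.adjoint ((A.adjoint - 1) ∘L T),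
    ContinuousLinearMap.adjoint_comp, map_sub, ContinuousLinearMap.adjoint_adjoint]
  congr 3
  exact ContinuousLinearMap.adjoint_id.symm

theorem tendsto_norm_phaseOp_conj_adjoint {T : HilbertL2 Y →L[ℂ] HilbertL2 X}
    (h : Tendsto (fun z : Z => ‖(phaseOp X (z : E)).adjoint ∘L T ∘L
      phaseOp Y (z : E) - T‖) (𝓝 0) (𝓝 0)) :
    Tendsto (fun z : Z => ‖(phaseOp Y (z : E)).adjoint ∘L T.adjoint ∘L
      phaseOp X (z : E) - T.adjoint‖) (𝓝 0) (𝓝 0) := by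
  refine h.congr fun z => ?_
  rw [← LinearIsometryEquiv.norm_map ContinuousLinearMap.adjoint, map_sub, adjoint_conj]

theorem tendsto_norm_adjoint_comp_translOp {T : HilbertL2 Y →L[ℂ] HilbertL2 X}
    (h : Tendsto (fun x : X => ‖(translOp X x - 1) ∘L T‖) (𝓝 0) (𝓝 0)) :
    Tendsto (fun x : X => ‖T.adjoint ∘L (translOp X x - 1)‖) (𝓝 0) (𝓝 0) := by
  have hneg : Tendsto (fun x : X => -x) (𝓝 0) (𝓝 0) := by
    simpa using (continuous_neg (G := X)).tendsto 0
  refine (h.comp hneg).congr fun x => ?_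
  rw [norm_adjoint_comp_sub_one, adjoint_translOp, Function.comp_apply]

theorem tendsto_norm_adjoint_comp_phaseOp {T : HilbertL2 Y →L[ℂ] HilbertL2 X}
    (h : Tendsto (fun k : ↥(X ⊓ Zᗮ) => ‖(phaseOp X (k : E) - 1) ∘L T‖) (𝓝 0) (𝓝 0)) :
    Tendsto (fun k : ↥(X ⊓ Zᗮ) => ‖T.adjoint ∘L (phaseOp X (k : E) - 1)‖) (𝓝 0) (𝓝 0) := by
  have hneg : Tendsto (fun k : ↥(X ⊓ Zᗮ) => -k) (𝓝 0) (𝓝 0) := by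
    simpa using (continuous_neg (G := ↥(X ⊓ Zᗮ))).tendsto 0
  refine (h.comp hneg).congr fun k => ?_
  rw [norm_adjoint_comp_sub_one, adjoint_phaseOp, Function.comp_apply, Submodule.coe_neg]

theorem mem_couplingSpace_of_tendsto_left (hZX : Z ≤ X) (hZY : Z ≤ Y)
    {T : HilbertL2 Y →L[ℂ] HilbertL2 X}
    (hinv : ∀ z : Z, (translOp X (Submodule.inclusion hZX z)).adjoint ∘L T ∘L
      translOp Y (Submodule.inclusion hZY z) = T)
    (hphase : Tendsto (fun z : Z => ‖(phaseOp X (z : E)).adjoint ∘L T ∘L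
      phaseOp Y (z : E) - T‖) (𝓝 0) (𝓝 0))
    (htransl : Tendsto (fun x : X => ‖(translOp X x - 1) ∘L T‖) (𝓝 0) (𝓝 0))
    (hperp : Tendsto (fun k : ↥(X ⊓ Zᗮ) => ‖(phaseOp X (k : E) - 1) ∘L T‖) (𝓝 0) (𝓝 0)) :
    T ∈ couplingSpace X Y G Z hX hY := by
  have h : T.adjoint ∈ couplingSpace Y X G Z hY hX := by
    refine mem_couplingSpace_of_tendsto hZY hZX (fun z => ?_)
      (tendsto_norm_phaseOp_conj_adjoint hphase) (tendsto_norm_adjoint_comp_translOp htransl)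
      (tendsto_norm_adjoint_comp_phaseOp hperp)
    rw [← adjoint_conj, hinv]
  -- The missing right-hand conditions on T are the left-hand ones for T^*, which hold because T^*
  -- lies in 𝒞_{YX}(Z).
  refine mem_couplingSpace_of_tendsto hZX hZY hinv hphase ?_ ?_
  · simpa only [ContinuousLinearMap.adjoint_adjoint] using
      tendsto_norm_adjoint_comp_translOp (tendsto_translOp_comp_of_mem_couplingSpace h)
  · simpa only [ContinuousLinearMap.adjoint_adjoint] using
      tendsto_norm_adjoint_comp_phaseOp (tendsto_phaseOp_comp_of_mem_couplingSpace hZX h)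

end Adjoint

end

end ManyBody

end

theorem corollary1p2 {E : Type*} [NormedAddCommGroup E] [InnerProductSpace ℝ E]
    [MeasurableSpace E] [BorelSpace E]
    -- the family `𝒮` of finite-dimensional subspaces of the prehilbert space `E`
    (S : Set (Submodule ℝ E))
    [∀ W : S, FiniteDimensional ℝ (W : Submodule ℝ E)]
    (hinf : ∀ X ∈ S, ∀ Y ∈ S, X ⊓ Y ∈ S)
    (hsup : ∀ X ∈ S, ∀ Y ∈ S, ∃ G ∈ S, X ⊔ Y ≤ G)
    -- `Z ⊆ X ∩ Y`, and `G` is any member of `𝒮` that contains `X` and `Y`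
    (X Y Z G : S) (hZX : Z.1 ≤ X.1) (hZY : Z.1 ≤ Y.1) (hX : X.1 ≤ G.1) (hY : Y.1 ≤ G.1) :
    -- the characterization by conditions (i) and (ii)
    (couplingSpace X.1 Y.1 G.1 Z.1 hX hY : Set (HilbertL2 Y.1 →L[ℂ] HilbertL2 X.1)) =
      {T | ((∀ z : Z.1, (translOp X.1 (Submodule.inclusion hZX z)).adjoint ∘L T ∘L
              translOp Y.1 (Submodule.inclusion hZY z) = T) ∧
            Tendsto (fun z : Z.1 => ‖(phaseOp X.1 (z : E)).adjoint ∘L T ∘L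
              phaseOp Y.1 (z : E) - T‖) (𝓝 0) (𝓝 0)) ∧
           (Tendsto (fun y : Y.1 => ‖T ∘L (translOp Y.1 y - 1)‖) (𝓝 0) (𝓝 0) ∧
            Tendsto (fun k : ↥(Y.1 ⊓ Z.1ᗮ) => ‖T ∘L (phaseOp Y.1 (k : E) - 1)‖)
              (𝓝 0) (𝓝 0))} ∧
    -- the characterization by conditions (i) and (iii)
    (couplingSpace X.1 Y.1 G.1 Z.1 hX hY : Set (HilbertL2 Y.1 →L[ℂ] HilbertL2 X.1)) =
      {T | ((∀ z : Z.1, (translOp X.1 (Submodule.inclusion hZX z)).adjoint ∘L T ∘L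
              translOp Y.1 (Submodule.inclusion hZY z) = T) ∧
            Tendsto (fun z : Z.1 => ‖(phaseOp X.1 (z : E)).adjoint ∘L T ∘L
              phaseOp Y.1 (z : E) - T‖) (𝓝 0) (𝓝 0)) ∧
           (Tendsto (fun x : X.1 => ‖(translOp X.1 x - 1) ∘L T‖) (𝓝 0) (𝓝 0) ∧
            Tendsto (fun k : ↥(X.1 ⊓ Z.1ᗮ) => ‖(phaseOp X.1 (k : E) - 1) ∘L T‖)
              (𝓝 0) (𝓝 0))} := by
  refine ⟨Set.Subset.antisymm (fun T hT => ?_) ?_, Set.Subset.antisymm (fun T hT => ?_) ?_⟩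
  · exact ⟨⟨translOp_conj_of_mem_couplingSpace hZX hZY hT,
      tendsto_phaseOp_conj_of_mem_couplingSpace hT⟩,
      tendsto_comp_translOp_of_mem_couplingSpace hT,
      tendsto_comp_phaseOp_of_mem_couplingSpace hZY hT⟩
  · rintro T ⟨⟨h1, h2⟩, h3, h4⟩
    exact mem_couplingSpace_of_tendsto hZX hZY h1 h2 h3 h4
  · exact ⟨⟨translOp_conj_of_mem_couplingSpace hZX hZY hT,
      tendsto_phaseOp_conj_of_mem_couplingSpace hT⟩,
      tendsto_translOp_comp_of_mem_couplingSpace hT,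
      tendsto_phaseOp_comp_of_mem_couplingSpace hZY hT⟩
  · rintro T ⟨⟨h1, h2⟩, h3, h4⟩
    exact mem_couplingSpace_of_tendsto_left hZX hZY h1 h2 h3 h4
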